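/- All graphs are finite and simple. For a graph $G$ let $\alpha(G)$ be its independence number, $\Delta(G)$ its maximum degree, and $\mathrm{girth}(G)$ the length of a shortest cycle of $G$ ($+\infty$ if $G$ is a forest). The Hall ratio of $G$ is $\rho(G)=\max\{|V(H)|/\alpha(H) : H\subseteq G \text{ a subgraph with at least one vertex}\}$. For integers $d,g$ let $$\rho(d,g)=\sup\{\rho(G) : G \text{ a graph with } \Delta(G)\le d \text{ and } \mathrm{girth}(G)\ge g\}.$$ Then the following upper bounds hold. For $d=3$: $\rho(3,6)\le\frac{30}{11}$, $\rho(3,7)\le\frac{30}{11}\ (\approx 2.727273)$, $\rho(3,8)\le\frac{5849}{2228}\ (\approx 2.625224)$, $\rho(3,9)\le\frac{125}{48}\ (\approx 2.604167)$, $\rho(3,10)\le\frac{2098873192}{820777797}\ (\approx 2.557176)$, $\rho(3,11)\le\frac{14147193}{5571665}\ (\approx 2.539132)$, $\rho(3,12)\le\frac{29727802051155412}{11841961450578397}\ (\approx 2.510378)$. For $d=4$: $\rho(4,6)\le\frac{41}{13}$, $\rho(4,7)\le\frac{41}{13}\ (\approx 3.153846)$, $\rho(4,8)\le\frac{7083927}{2331392}\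 (\approx 3.038497)$, $\rho(4,9)\le\frac{127937}{42400}\ (\approx 3.017382)$, $\rho(4,10)\le 3$. For $d=5$: $\rho(5,6)\le\frac{69}{19}\ (\approx 3.631579)$, $\rho(5,7)\le\frac{18}{5}$, $\rho(5,8)\le\frac72$. -/

import Mathlib

/-- The Hall ratio `ρ(G) = max {|V(H)| / α(H) : H ⊆ G}` of a finite graph `G`, the maximum being over
all subgraphs `H` of `G` (the subgraph without vertices contributes `0 / 0 = 0`, every other one
at least `1`). -/
noncomputable def hallRatio {V : Type*} [Finite V] (G : SimpleGraph V) : ℝ :=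
  ⨆ H : G.Subgraph, (Nat.card H.verts : ℝ) / (H.coe.indepNum : ℝ)

open Classical in
/-- `ρ(d, g)`: the supremum, in the extended reals, of the Hall ratios of all finite graphs of
maximum degree at most `d` and girth at least `g` (forests have girth `∞`). -/
noncomputable def hallRatioSup (d g : ℕ) : EReal :=
  ⨆ (n : ℕ) (G : SimpleGraph (Fin n)) (_ : G.maxDegree ≤ d) (_ : (g : ℕ∞) ≤ G.egirth),
    ((hallRatio G : ℝ) : EReal)

/-- The table of upper bounds: the triple `(d, g, b)` stands for the entry `b` in row `d` and
column `g`. -/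
def hallRatioTable : List (ℕ × ℕ × ℚ) :=
  [(3, 6, 30 / 11),
   (3, 7, 30 / 11),
   (3, 8, 5849 / 2228),
   (3, 9, 125 / 48),
   (3, 10, 2098873192 / 820777797),
   (3, 11, 14147193 / 5571665),
   (3, 12, 29727802051155412 / 11841961450578397),
   (4, 6, 41 / 13),
   (4, 7, 41 / 13),
   (4, 8, 7083927 / 2331392),
   (4, 9, 127937 / 42400),
   (4, 10, 3),
   (5, 6, 69 / 19),
   (5, 7, 18 / 5),
   (5, 8, 7 / 2)]

/-! Subgraphs inherit degree and girth bounds, so it suffices to prove |V| ≤ b·α(G) throughout the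
class. The graph may moreover be taken d-regular: copies of G, indexed by a finite group generated
without short relations, are joined at the vertices of too small degree. This keeps the girth at
least g and does not lower |V|/α (`card_le_of_forall_isRegularOfDegree`).

For a regular graph, let I be a uniformly random maximum independent set. Attach to each vertex
(even girth) or directed edge (odd girth) a weight of I that depends only on I inside the
surrounding ball S, chosen so that all local weights add up to T·|I|. Fix J = I \ S. Then I ∩ S is
uniform among the largest independent subsets of S without neighbours in J, because any of them can
replace I ∩ S. If the conditional mean of the local weight is at least D for every J, then D times
the number of places is at most T·α(G) (`mul_card_maxIndepSets_le`, `card_mul_le_of_average`).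

Large girth makes S a tree with no further edges, and J acts only by forbidding some leaves. Counts
and weights of largest independent sets therefore obey a recursion from the leaves to the root:
forests multiply (`HasForestType.mul`), and a new root changes the data according to the size
difference s (`HasForestType.node`). Up to scaling and lowering of weights, only finitely many data
occur at each depth (`exists_hasForestType`). The inequality at the root is then a finite integer
computation, carried out with explicit level weights in `vertexCheck` and `edgeCheck`.

For girth six the weight is not linear in I: a charge C is moved between vertices outside I
according to whether they have exactly one neighbour in I (`mul_card_le_of_cherry_check`). The
resulting bounds serve the columns 6 and 7, and all columns for d = 5. -/

namespace SimpleGraph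

/-! ### Short paths and tree-like branches in graphs of large girth -/

variable {V : Type*} {G : SimpleGraph V}

/-- Two paths with the same ends whose total length is less than the girth are equal. -/
theorem Walk.IsPath.eq_of_length_add_length_lt_egirth {a b : V} {p q : G.Walk a b}
    (hp : p.IsPath) (hq : q.IsPath) (h : ((p.length + q.length : ℕ) : ℕ∞) < G.egirth) :
    p = q := by
  classical
  -- The union of the two paths has too few edges to contain a cycle of `G`, so it is a forest, and
  -- paths in a forest are unique.
  let H : SimpleGraph V := fromEdgeSet {e | e ∈ p.edges ∨ e ∈ q.edges}
  have hHG : H ≤ G := by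
    intro x y hxy
    rcases hxy with ⟨hxy | hxy, -⟩
    · exact p.adj_of_mem_edges hxy
    · exact q.adj_of_mem_edges hxy
  have hpH : ∀ e ∈ p.edges, e ∈ H.edgeSet := by
    intro e he
    rw [edgeSet_fromEdgeSet]
    exact ⟨Or.inl he, G.not_isDiag_of_mem_edgeSet (p.edges_subset_edgeSet he)⟩
  have hqH : ∀ e ∈ q.edges, e ∈ H.edgeSet := by
    intro e he
    rw [edgeSet_fromEdgeSet]
    exact ⟨Or.inr he, G.not_isDiag_of_mem_edgeSet (q.edges_subset_edgeSet he)⟩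
  have hac : H.IsAcyclic := by
    intro v c hc
    have h1 : G.egirth ≤ c.length := by
      simpa using egirth_le_length (hc.mapLe hHG)
    have h2 : c.edges ⊆ p.edges ++ q.edges := by
      intro e he
      have := c.edges_subset_edgeSet he
      rw [edgeSet_fromEdgeSet] at this
      simpa using this.1
    have h3 : c.edges.length ≤ (p.edges ++ q.edges).length :=
      (hc.edges_nodup.subperm h2).length_le
    simp only [List.length_append, Walk.length_edges] at h3
    exact absurd (h.trans_le h1) (by exact_mod_cast not_lt.mpr h3)
  have := (hac.subsingleton_path a b).elim ⟨_, hp.transfer hpH⟩ ⟨_, hq.transfer hqH⟩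
  have h4 : p.transfer H hpH = q.transfer H hqH := congrArg Subtype.val this
  apply Walk.ext_support
  rw [← Walk.support_transfer p hpH, h4, Walk.support_transfer]

/-- Two short paths from neighbours of `w` to the same vertex that avoid `w` start at the same
vertex. -/
theorem Walk.IsPath.start_eq {w x x' z : V} {p : G.Walk x z} {q : G.Walk x' z}
    (hp : p.IsPath) (hq : q.IsPath) (hx : G.Adj w x) (hx' : G.Adj w x')
    (hwp : w ∉ p.support) (hwq : w ∉ q.support)
    (h : ((p.length + q.length + 2 : ℕ) : ℕ∞) < G.egirth) : x = x' := by
  have h1 : (Walk.cons hx p).IsPath := (Walk.cons_isPath_iff hx p).2 ⟨hp, hwp⟩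
  have h2 : (Walk.cons hx' q).IsPath := (Walk.cons_isPath_iff hx' q).2 ⟨hq, hwq⟩
  have h3 := h1.eq_of_length_add_length_lt_egirth h2 (lt_of_eq_of_lt (by
    simp only [Walk.length_cons]; congr 1; omega) h)
  have h4 := congrArg Walk.snd h3
  simpa using h4

variable [Fintype V] [DecidableEq V] [DecidableRel G.Adj]

variable (G) in
/-- The vertices of the branch of depth `m` at `w` that points away from `u`. -/
def branch : ℕ → V → V → Finset V
  | 0, _, _ => ∅
  | m + 1, u, w => insert w (((G.neighborFinset w).erase u).biUnion fun x => branch m w x)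

theorem mem_branch_succ {m : ℕ} {u w y : V} :
    y ∈ G.branch (m + 1) u w ↔ y = w ∨ ∃ x, x ≠ u ∧ G.Adj w x ∧ y ∈ G.branch m w x := by
  simp [branch, and_assoc]

theorem root_mem_branch (m : ℕ) (u w : V) : w ∈ G.branch (m + 1) u w := by
  simp [branch]

/-- Descending from parent to child gives the path. It cannot come back to `u`: its part up to `u`
together with the edge `uw` would be a cycle of length at most `m`. -/
theorem exists_path_of_mem_branch {m : ℕ} (hm : (m : ℕ∞) < G.egirth) {u w y : V}
    (huw : G.Adj u w) (hy : y ∈ G.branch m u w) :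
    ∃ p : G.Walk w y, p.IsPath ∧ u ∉ p.support ∧ p.length < m := by
  induction m generalizing u w with
  | zero => simp [branch] at hy
  | succ m ih =>
    rcases mem_branch_succ.1 hy with rfl | ⟨x, hxu, hwx, hy⟩
    · exact ⟨.nil, .nil, by simpa using huw.ne, by simp⟩
    · obtain ⟨p, hp, hwp, hpl⟩ := ih (lt_of_le_of_lt (by exact_mod_cast Nat.le_succ m) hm) hwx hy
      refine ⟨.cons hwx p, (Walk.cons_isPath_iff _ _).2 ⟨hp, hwp⟩, ?_, by simpa using hpl⟩
      simp only [Walk.support_cons, List.mem_cons, not_or]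
      refine ⟨huw.ne, fun hup => hxu ?_⟩
      have hlen := p.length_takeUntil_le_length hup
      exact (hp.takeUntil hup).start_eq (Walk.IsPath.nil (u := u)) hwx huw.symm
        (fun h => hwp (p.support_takeUntil_subset_support hup h)) (by simpa using huw.ne')
        (lt_of_le_of_lt (by simp only [Walk.length_nil]; exact_mod_cast (by omega)) hm)

theorem notMem_branch {m : ℕ} (hm : (m : ℕ∞) < G.egirth) {u w : V} (huw : G.Adj u w) :
    u ∉ G.branch m u w := fun h => by
  obtain ⟨p, -, hu, -⟩ := exists_path_of_mem_branch hm huw h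
  exact hu p.end_mem_support

theorem eq_root_of_adj_of_mem_branch {m : ℕ} (hm : ((m + 1 : ℕ) : ℕ∞) < G.egirth) {u w y : V}
    (huw : G.Adj u w) (hy : y ∈ G.branch m u w) (huy : G.Adj u y) : y = w := by
  obtain ⟨p, hp, hu, hl⟩ :=
    exists_path_of_mem_branch (lt_of_le_of_lt (by exact_mod_cast Nat.le_succ m) hm) huw hy
  exact ((hp.start_eq (Walk.IsPath.nil (u := y)) huw huy hu (by simpa using huy.ne))
    (lt_of_le_of_lt (by simp only [Walk.length_nil]; exact_mod_cast (by omega)) hm)).symm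

theorem disjoint_branch {m n : ℕ} (h : ((m + n : ℕ) : ℕ∞) < G.egirth) {w x x' : V}
    (hx : G.Adj w x) (hx' : G.Adj w x') (hne : x ≠ x') :
    Disjoint (G.branch m w x) (G.branch n w x') := by
  rw [Finset.disjoint_left]
  intro y hy hy'
  obtain ⟨p, hp, hwp, hpl⟩ :=
    exists_path_of_mem_branch (lt_of_le_of_lt (by exact_mod_cast Nat.le_add_right m n) h) hx hy
  obtain ⟨q, hq, hwq, hql⟩ :=
    exists_path_of_mem_branch (lt_of_le_of_lt (by exact_mod_cast Nat.le_add_left n m) h) hx' hy'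
  exact hne (hp.start_eq hq hx hx' hwp hwq (lt_of_le_of_lt (by exact_mod_cast (by omega)) h))

/-- An edge between the branches would close a cycle through `w` of length at most `m + n + 1`. -/
theorem not_adj_branch {m n : ℕ} (h : ((m + n + 1 : ℕ) : ℕ∞) < G.egirth) {w x x' y y' : V}
    (hx : G.Adj w x) (hx' : G.Adj w x') (hne : x ≠ x') (hy : y ∈ G.branch m w x)
    (hy' : y' ∈ G.branch n w x') : ¬ G.Adj y y' := by
  intro hyy
  obtain ⟨p, hp, hwp, hpl⟩ :=
    exists_path_of_mem_branch (lt_of_le_of_lt (by exact_mod_cast (by omega)) h) hx hy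
  obtain ⟨q, hq, hwq, hql⟩ :=
    exists_path_of_mem_branch (lt_of_le_of_lt (by exact_mod_cast (by omega)) h) hx' hy'
  have hwy' : w ≠ y' := fun e => hwq (e ▸ q.end_mem_support)
  -- A path from `x` to `y'` is obtained by cutting `p` at `y'` if it passes there, and by appending
  -- the edge otherwise.
  by_cases hmem : y' ∈ p.support
  · have hlen := p.length_takeUntil_le_length hmem
    exact hne ((hp.takeUntil hmem).start_eq hq hx hx'
      (fun h => hwp (p.support_takeUntil_subset_support hmem h)) hwq
      (lt_of_le_of_lt (by exact_mod_cast (by omega)) h))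
  · refine hne ((hp.concat hmem hyy).start_eq hq hx hx' ?_ hwq
      (lt_of_le_of_lt (by rw [Walk.length_concat]; exact_mod_cast (by omega)) h))
    simp [Walk.support_concat, hwp, hwy']

end SimpleGraph

/-! ### Numerical data of rooted forests -/

section

open Finset

/-- Numerical data of a rooted forest in which independent sets are chosen: `cb` and `cf` are
proportional to the numbers of largest independent sets that avoid all roots and of largest
independent sets, `wb` and `wf` are proportional to (lower bounds for) the total weights of these
sets, and `s` is the difference of the two sizes. -/
@[ext]
structure ForestType where
  s : ℕ
  cb : ℕ
  cf : ℕ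
  wb : ℕ
  wf : ℕ

namespace ForestType

instance : One ForestType := ⟨⟨0, 1, 1, 0, 0⟩⟩

/-- The data of a disjoint union of forests. -/
instance : Mul ForestType :=
  ⟨fun t u => ⟨Nat.add t.s u.s, Nat.mul t.cb u.cb, Nat.mul t.cf u.cf,
    Nat.add (Nat.mul t.cb u.wb) (Nat.mul t.wb u.cb),
    Nat.add (Nat.mul t.cf u.wf) (Nat.mul t.wf u.cf)⟩⟩

@[simp] theorem one_s : (1 : ForestType).s = 0 := rfl
@[simp] theorem one_cb : (1 : ForestType).cb = 1 := rfl
@[simp] theorem one_cf : (1 : ForestType).cf = 1 := rfl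
@[simp] theorem one_wb : (1 : ForestType).wb = 0 := rfl
@[simp] theorem one_wf : (1 : ForestType).wf = 0 := rfl
@[simp] theorem mul_s (t u : ForestType) : (t * u).s = t.s + u.s := rfl
@[simp] theorem mul_cb (t u : ForestType) : (t * u).cb = t.cb * u.cb := rfl
@[simp] theorem mul_cf (t u : ForestType) : (t * u).cf = t.cf * u.cf := rfl
@[simp] theorem mul_wb (t u : ForestType) : (t * u).wb = t.cb * u.wb + t.wb * u.cb := rfl
@[simp] theorem mul_wf (t u : ForestType) : (t * u).wf = t.cf * u.wf + t.wf * u.cf := rfl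

instance : CommMonoid ForestType where
  mul_assoc t u v := by ext <;> simp <;> ring
  one_mul t := by ext <;> simp
  mul_one t := by ext <;> simp
  mul_comm t u := by ext <;> simp <;> ring

/-- The data of the tree obtained by joining a new root of weight `a` to the roots of a forest. -/
def node (a : ℕ) : ForestType → ForestType
  | ⟨0, cb, cf, wb, wf⟩ => ⟨1, cf, cb, wf, wb + a * cb⟩
  | ⟨1, cb, cf, wb, wf⟩ => ⟨0, cf, cf + cb, wf, wf + (wb + a * cb)⟩
  | ⟨_ + 2, _, cf, _, wf⟩ => ⟨0, cf, cf, wf, wf⟩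

/-- `t` is at most as favourable as `u`. -/
def Dominated (t u : ForestType) : Prop :=
  t.s = u.s ∧ 0 < t.cf ∧ t.cb * u.cf = u.cb * t.cf ∧ t.wb * u.cf ≤ u.wb * t.cf ∧
    t.wf * u.cf ≤ u.wf * t.cf

end ForestType

/-! ### Largest independent extensions into a forest -/

namespace SimpleGraph

variable {V : Type*} (G : SimpleGraph V) [DecidableRel G.Adj]

/-- The independent subsets of `S` that have no neighbour in `J`. -/
def indepFamily (J S : Finset V) : Finset (Finset V) :=
  {K ∈ S.powerset | (∀ a ∈ K, ∀ b ∈ K, ¬ G.Adj a b) ∧ ∀ a ∈ K, ∀ b ∈ J, ¬ G.Adj a b}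

variable {G}

theorem mem_indepFamily {J S K : Finset V} : K ∈ G.indepFamily J S ↔
    K ⊆ S ∧ (∀ a ∈ K, ∀ b ∈ K, ¬ G.Adj a b) ∧ ∀ a ∈ K, ∀ b ∈ J, ¬ G.Adj a b := by
  simp [indepFamily]

theorem indepFamily_empty (J : Finset V) : G.indepFamily J ∅ = {∅} := by
  ext K
  simp only [mem_indepFamily, subset_empty, mem_singleton, and_iff_left_iff_imp]
  rintro rfl
  simp

variable [DecidableEq V]

theorem sum_indepFamily_union {J S T : Finset V} (hST : Disjoint S T)
    (hadj : ∀ a ∈ S, ∀ b ∈ T, ¬ G.Adj a b) (f : Finset V → ℝ) :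
    ∑ K ∈ G.indepFamily J (S ∪ T), f K =
      ∑ p ∈ G.indepFamily J S ×ˢ G.indepFamily J T, f (p.1 ∪ p.2) := by
  symm
  refine sum_nbij' (fun p => p.1 ∪ p.2) (fun K => (K ∩ S, K ∩ T)) ?_ ?_ ?_ ?_ ?_
  · rintro ⟨K, L⟩ h
    simp only [mem_product, mem_indepFamily] at h ⊢
    obtain ⟨⟨hK, hK1, hK2⟩, hL, hL1, hL2⟩ := h
    refine ⟨union_subset_union hK hL, ?_, ?_⟩
    · intro a ha b hb hab
      rcases mem_union.1 ha with ha | ha <;> rcases mem_union.1 hb with hb | hb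
      · exact hK1 a ha b hb hab
      · exact hadj a (hK ha) b (hL hb) hab
      · exact hadj b (hK hb) a (hL ha) hab.symm
      · exact hL1 a ha b hb hab
    · intro a ha
      rcases mem_union.1 ha with ha | ha
      · exact hK2 a ha
      · exact hL2 a ha
  · intro K h
    simp only [mem_product, mem_indepFamily] at h ⊢
    obtain ⟨hK, hK1, hK2⟩ := h
    exact ⟨⟨inter_subset_right, fun a ha b hb => hK1 a (mem_inter.1 ha).1 b (mem_inter.1 hb).1,
      fun a ha => hK2 a (mem_inter.1 ha).1⟩, inter_subset_right,
      fun a ha b hb => hK1 a (mem_inter.1 ha).1 b (mem_inter.1 hb).1,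
      fun a ha => hK2 a (mem_inter.1 ha).1⟩
  · rintro ⟨K, L⟩ h
    simp only [mem_product, mem_indepFamily] at h
    have h1 : L ∩ S = ∅ := disjoint_iff_inter_eq_empty.1 (hST.symm.mono_left h.2.1)
    have h2 : K ∩ T = ∅ := disjoint_iff_inter_eq_empty.1 (hST.mono_left h.1.1)
    simp [union_inter_distrib_right, h1, h2, inter_eq_left.2 h.1.1, inter_eq_left.2 h.2.1]
  · intro K h
    rw [mem_indepFamily] at h
    simp only
    rw [← inter_union_distrib_left, inter_eq_left.2 h.1]
  · simp

/-- Split by membership of `w`: sets containing `w` lose exactly its neighbours `R` inside `S`. -/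
theorem sum_indepFamily_insert {J S R : Finset V} {w : V} (hwS : w ∉ S)
    (hadj : ∀ y ∈ S, G.Adj w y ↔ y ∈ R) (hJ : ∀ b ∈ J, ¬ G.Adj w b) (f : Finset V → ℝ) :
    ∑ K ∈ G.indepFamily J (insert w S), f K =
      ∑ K ∈ G.indepFamily J S, f K + ∑ K ∈ G.indepFamily J (S \ R), f (insert w K) := by
  rw [← sum_filter_add_sum_filter_not _ (fun K => w ∉ K)]
  congr 1
  · refine sum_congr ?_ fun _ _ => rfl
    ext K
    simp only [mem_filter, mem_indepFamily]
    constructor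
    · rintro ⟨⟨h1, h2⟩, h3⟩
      exact ⟨(subset_insert_iff_of_notMem h3).1 h1, h2⟩
    · rintro ⟨h1, h2⟩
      exact ⟨⟨h1.trans (subset_insert _ _), h2⟩, fun h => hwS (h1 h)⟩
  · symm
    refine sum_nbij' (fun K => insert w K) (fun K => K.erase w) ?_ ?_ ?_ ?_ ?_
    · intro K h
      simp only [mem_filter, mem_indepFamily, not_not] at h ⊢
      obtain ⟨h1, h2, h3⟩ := h
      have hw : ∀ a ∈ K, ¬ G.Adj w a := fun a ha h => by
        have := mem_sdiff.1 (h1 ha)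
        exact this.2 ((hadj a this.1).1 h)
      refine ⟨⟨insert_subset_insert _ (h1.trans sdiff_subset), ?_, ?_⟩, mem_insert_self _ _⟩
      · intro a ha b hb
        rcases mem_insert.1 ha with rfl | ha <;> rcases mem_insert.1 hb with rfl | hb
        · exact G.loopless.irrefl _
        · exact hw _ ‹_›
        · exact fun h => hw _ ‹_› h.symm
        · exact h2 a ha b hb
      · intro a ha
        rcases mem_insert.1 ha with rfl | ha
        · exact hJ
        · exact h3 a ha
    · intro K h
      simp only [mem_filter, mem_indepFamily, not_not] at h ⊢
      obtain ⟨⟨h1, h2, h3⟩, h4⟩ := h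
      refine ⟨fun a ha => ?_, fun a ha b hb => h2 a (mem_of_mem_erase ha) b (mem_of_mem_erase hb),
        fun a ha => h3 a (mem_of_mem_erase ha)⟩
      obtain ⟨haw, haK⟩ := mem_erase.1 ha
      have haS : a ∈ S := (mem_insert.1 (h1 haK)).resolve_left haw
      exact mem_sdiff.2 ⟨haS, fun haR => h2 w h4 a haK ((hadj a haS).2 haR)⟩
    · intro K h
      rw [mem_indepFamily] at h
      exact erase_insert fun hw => hwS (mem_sdiff.1 (h.1 hw)).1
    · intro K h
      simp only [mem_filter, not_not] at h
      exact insert_erase h.2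
    · simp

/-- `n` is the largest size of a member of `F`, there are `c` members of that size, and their total
weight is at least `w`. -/
structure IsTop (F : Finset (Finset V)) (φ : Finset V → ℝ) (n : ℕ) (c w : ℝ) : Prop where
  card_le : ∀ K ∈ F, #K ≤ n
  pos : 0 < c
  count : ∑ K ∈ F, (if #K = n then 1 else 0) = c
  weight : w ≤ ∑ K ∈ F, (if #K = n then φ K else 0)

/-- Without edges between the parts, a set is largest exactly when both traces are largest. Hence
sizes add, counts multiply, and total weights follow a product rule. -/
theorem IsTop.union {J S T : Finset V} {φ ψ χ : Finset V → ℝ} {n m : ℕ} {c w c' w' : ℝ}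
    (hST : Disjoint S T) (hadj : ∀ a ∈ S, ∀ b ∈ T, ¬ G.Adj a b)
    (h : IsTop (G.indepFamily J S) φ n c w) (h' : IsTop (G.indepFamily J T) ψ m c' w')
    (hχ : ∀ K ⊆ S, ∀ L ⊆ T, χ (K ∪ L) = φ K + ψ L) :
    IsTop (G.indepFamily J (S ∪ T)) χ (n + m) (c * c') (c * w' + w * c') := by
  have hsub : ∀ {K S : Finset V}, K ∈ G.indepFamily J S → K ⊆ S := fun h => (mem_indepFamily.1 h).1
  have hcard : ∀ p ∈ G.indepFamily J S ×ˢ G.indepFamily J T, #(p.1 ∪ p.2) = #p.1 + #p.2 :=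
    fun p hp => card_union_of_disjoint
      (hST.mono (hsub (mem_product.1 hp).1) (hsub (mem_product.1 hp).2))
  have key : ∀ p ∈ G.indepFamily J S ×ˢ G.indepFamily J T,
      (#(p.1 ∪ p.2) = n + m ↔ #p.1 = n ∧ #p.2 = m) := fun p hp => by
    have h1 := h.card_le _ (mem_product.1 hp).1
    have h2 := h'.card_le _ (mem_product.1 hp).2
    rw [hcard p hp]
    omega
  refine ⟨?_, mul_pos h.pos h'.pos, ?_, ?_⟩
  · intro K hK
    have hK' := mem_indepFamily.1 hK
    have h1 := h.card_le (K ∩ S) (mem_indepFamily.2 ⟨inter_subset_right,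
      fun a ha b hb => hK'.2.1 a (mem_inter.1 ha).1 b (mem_inter.1 hb).1,
      fun a ha => hK'.2.2 a (mem_inter.1 ha).1⟩)
    have h2 := h'.card_le (K ∩ T) (mem_indepFamily.2 ⟨inter_subset_right,
      fun a ha b hb => hK'.2.1 a (mem_inter.1 ha).1 b (mem_inter.1 hb).1,
      fun a ha => hK'.2.2 a (mem_inter.1 ha).1⟩)
    have h3 : K = K ∩ S ∪ K ∩ T := by rw [← inter_union_distrib_left, inter_eq_left.2 hK'.1]
    calc #K ≤ #(K ∩ S) + #(K ∩ T) := by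
          conv_lhs => rw [h3]
          exact card_union_le _ _
      _ ≤ n + m := add_le_add h1 h2
  · rw [sum_indepFamily_union hST hadj, ← h.count, ← h'.count, sum_mul_sum, ← sum_product']
    refine sum_congr rfl fun p hp => ?_
    by_cases h1 : #p.1 = n <;> by_cases h2 : #p.2 = m <;> simp [key p hp, h1, h2]
  · rw [sum_indepFamily_union hST hadj]
    calc c * w' + w * c' ≤
        c * ∑ K ∈ G.indepFamily J T, (if #K = m then ψ K else 0) +
          (∑ K ∈ G.indepFamily J S, (if #K = n then φ K else 0)) * c' :=
          add_le_add (mul_le_mul_of_nonneg_left h'.weight h.pos.le)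
            (mul_le_mul_of_nonneg_right h.weight h'.pos.le)
      _ = _ := by
        rw [← h.count, ← h'.count, sum_mul_sum, sum_mul_sum, ← sum_product', ← sum_product',
          ← sum_add_distrib]
        refine sum_congr rfl fun p hp => ?_
        have hp' := mem_product.1 hp
        have := hχ _ (hsub hp'.1) _ (hsub hp'.2)
        by_cases h1 : #p.1 = n <;> by_cases h2 : #p.2 = m <;>
          simp [key p hp, h1, h2, this, add_comm]

/-- Relative to the outside set `J`, the forest on `S` with roots `R` and the weight `φ` has the
data `t`. -/
structure HasForestType (G : SimpleGraph V) [DecidableRel G.Adj] (J S R : Finset V)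
    (φ : Finset V → ℝ) (t : ForestType) : Prop where
  subset : R ⊆ S
  congr : ∀ K L : Finset V, K ∩ S = L ∩ S → φ K = φ L
  isTop : ∃ (n : ℕ) (ρ : ℝ), 0 < ρ ∧
    IsTop (G.indepFamily J S) φ (n + t.s) (ρ * t.cf) (ρ * t.wf) ∧
    IsTop (G.indepFamily J (S \ R)) φ n (ρ * t.cb) (ρ * t.wb)

theorem HasForestType.empty (J : Finset V) :
    HasForestType G J ∅ ∅ (fun _ => 0) 1 := by
  have : IsTop (G.indepFamily J ∅) (fun _ => (0 : ℝ)) 0 1 0 := by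
    rw [indepFamily_empty]
    constructor <;> simp
  exact ⟨subset_rfl, fun _ _ _ => rfl, 0, 1, one_pos, by simpa using this, by simpa using this⟩

theorem HasForestType.mul {J S R S' R' : Finset V} {φ φ' : Finset V → ℝ} {t t' : ForestType}
    (h : HasForestType G J S R φ t) (h' : HasForestType G J S' R' φ' t') (hS : Disjoint S S')
    (hadj : ∀ a ∈ S, ∀ b ∈ S', ¬ G.Adj a b) :
    HasForestType G J (S ∪ S') (R ∪ R') (fun K => φ K + φ' K) (t * t') := by
  obtain ⟨n, ρ, hρ, h1, h2⟩ := h.isTop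
  obtain ⟨n', ρ', hρ', h1', h2'⟩ := h'.isTop
  have hinter : ∀ K ⊆ S, ∀ L ⊆ S', φ (K ∪ L) + φ' (K ∪ L) = φ K + φ' L := by
    intro K hK L hL
    congr 1
    · refine h.congr _ _ ?_
      rw [union_inter_distrib_right, disjoint_iff_inter_eq_empty.1 (hS.symm.mono_left hL),
        union_empty]
    · refine h'.congr _ _ ?_
      rw [union_inter_distrib_right, disjoint_iff_inter_eq_empty.1 (hS.mono_left hK),
        empty_union]
  refine ⟨union_subset_union h.subset h'.subset, ?_, n + n', ρ * ρ', mul_pos hρ hρ', ?_, ?_⟩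
  · intro K L hKL
    have e : ∀ T ⊆ S ∪ S', K ∩ T = L ∩ T := fun T hT => by
      rw [← inter_eq_right.2 hT, ← inter_assoc, hKL, inter_assoc]
    rw [h.congr K L (e _ subset_union_left), h'.congr K L (e _ subset_union_right)]
  · have := IsTop.union (χ := fun K => φ K + φ' K) hS hadj h1 h1' hinter
    convert this using 1
    · simp only [ForestType.mul_s]; omega
    · push_cast [ForestType.mul_cf]; ring
    · push_cast [ForestType.mul_wf]; ring
  · have e : (S ∪ S') \ (R ∪ R') = S \ R ∪ S' \ R' := by
      ext x
      have a1 : x ∈ R → x ∈ S := fun hx => h.subset hx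
      have a2 : x ∈ R' → x ∈ S' := fun hx => h'.subset hx
      have a3 : x ∈ S → x ∉ S' := fun hx => Finset.disjoint_left.1 hS hx
      simp only [mem_sdiff, mem_union]
      tauto
    rw [e]
    have := IsTop.union (χ := fun K => φ K + φ' K) (hS.mono sdiff_subset sdiff_subset)
      (fun a ha b hb => hadj a (sdiff_subset ha) b (sdiff_subset hb)) h2 h2'
      (fun K hK L hL => hinter K (hK.trans sdiff_subset) L (hL.trans sdiff_subset))
    convert this using 1
    · push_cast [ForestType.mul_cb]; ring
    · push_cast [ForestType.mul_wb]; ring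

theorem HasForestType.prod {ι : Type*} [DecidableEq ι] {J : Finset V} (C : Finset ι)
    {S R : ι → Finset V} {φ : ι → Finset V → ℝ} {t : ι → ForestType}
    (h : ∀ i ∈ C, HasForestType G J (S i) (R i) (φ i) (t i))
    (hS : ∀ i ∈ C, ∀ j ∈ C, i ≠ j → Disjoint (S i) (S j))
    (hadj : ∀ i ∈ C, ∀ j ∈ C, i ≠ j → ∀ a ∈ S i, ∀ b ∈ S j, ¬ G.Adj a b) :
    HasForestType G J (C.biUnion S) (C.biUnion R) (fun K => ∑ i ∈ C, φ i K) (∏ i ∈ C, t i) := by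
  induction C using Finset.induction_on with
  | empty => simpa using HasForestType.empty J
  | insert i C hi ih =>
    simp only [biUnion_insert, prod_insert hi, sum_insert hi]
    refine (h i (mem_insert_self _ _)).mul (ih ?_ ?_ ?_) ?_ ?_
    · exact fun j hj => h j (mem_insert_of_mem hj)
    · exact fun j hj k hk => hS j (mem_insert_of_mem hj) k (mem_insert_of_mem hk)
    · exact fun j hj k hk => hadj j (mem_insert_of_mem hj) k (mem_insert_of_mem hk)
    · rw [disjoint_biUnion_right]
      exact fun j hj => hS i (mem_insert_self _ _) j (mem_insert_of_mem hj)
        (fun e => hi (e ▸ hj))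
    · intro a ha b hb
      obtain ⟨j, hj, hb⟩ := mem_biUnion.1 hb
      exact hadj i (mem_insert_self _ _) j (mem_insert_of_mem hj) (fun e => hi (e ▸ hj)) a ha b hb

/-- The best sets containing the new root have size `n + 1`, since they must avoid the old roots;
the best ones without it have size `n + t.s`. So for `t.s = 0` the new root is always used, for `t.s
= 1` both kinds compete, and for `t.s ≥ 2` it is never used. Avoiding the new root leaves the whole
old forest, whence the new `cb` and `wb` are the old `cf` and `wf`. -/
theorem HasForestType.node {J S R : Finset V} {φ : Finset V → ℝ} {t : ForestType}
    (h : HasForestType G J S R φ t) {w : V} (hwS : w ∉ S)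
    (hadj : ∀ y ∈ S, G.Adj w y ↔ y ∈ R) (hJ : ∀ b ∈ J, ¬ G.Adj w b) (a : ℕ) :
    HasForestType G J (insert w S) {w} (fun K => (if w ∈ K then (a : ℝ) else 0) + φ K)
      (t.node a) := by
  obtain ⟨n, ρ, hρ, h1, h2⟩ := h.isTop
  have hsub : ∀ {K S : Finset V}, K ∈ G.indepFamily J S → K ⊆ S := fun h => (mem_indepFamily.1 h).1
  have hφ : ∀ K, φ (insert w K) = φ K := fun K => h.congr _ _ (insert_inter_of_notMem hwS)
  have hwK : ∀ K ∈ G.indepFamily J S, w ∉ K := fun K hK hw => hwS (hsub hK hw)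
  have hwK' : ∀ K ∈ G.indepFamily J (S \ R), w ∉ K :=
    fun K hK hw => hwS (mem_sdiff.1 (hsub hK hw)).1
  have hout : insert w S \ {w} = S := by
    rw [← erase_eq, erase_insert hwS]
  have hle : ∀ N : ℕ, n + t.s ≤ N → n + 1 ≤ N → ∀ K ∈ G.indepFamily J (insert w S), #K ≤ N := by
    intro N hN hN' K hK
    have hK' := mem_indepFamily.1 hK
    by_cases hw : w ∈ K
    · have : K.erase w ∈ G.indepFamily J (S \ R) := by
        refine mem_indepFamily.2 ⟨fun y hy => ?_, fun y hy z hz =>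
          hK'.2.1 y (mem_of_mem_erase hy) z (mem_of_mem_erase hz),
          fun y hy => hK'.2.2 y (mem_of_mem_erase hy)⟩
        obtain ⟨hyw, hyK⟩ := mem_erase.1 hy
        have hyS : y ∈ S := (mem_insert.1 (hK'.1 hyK)).resolve_left hyw
        exact mem_sdiff.2 ⟨hyS, fun hyR => hK'.2.1 w hw y hyK ((hadj y hyS).2 hyR)⟩
      have := h2.card_le _ this
      rw [card_erase_of_mem hw] at this
      omega
    · exact (h1.card_le K (mem_indepFamily.2
        ⟨(subset_insert_iff_of_notMem hw).1 hK'.1, hK'.2⟩)).trans hN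
  have hfree : IsTop (G.indepFamily J S) (fun K => (if w ∈ K then (a : ℝ) else 0) + φ K)
      (n + t.s) (ρ * t.cf) (ρ * t.wf) := by
    refine ⟨h1.card_le, h1.pos, h1.count, h1.weight.trans_eq (sum_congr rfl fun K hK => ?_)⟩
    simp [hwK K hK]
  have hin : ∑ K ∈ G.indepFamily J (S \ R), (if #(insert w K) = n + 1 then (1 : ℝ) else 0) =
      ρ * t.cb := by
    rw [← h2.count]
    refine sum_congr rfl fun K hK => ?_
    rw [card_insert_of_notMem (hwK' K hK)]
    simp
  have hinw : ρ * (t.wb + a * t.cb : ℕ) ≤ ∑ K ∈ G.indepFamily J (S \ R),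
      (if #(insert w K) = n + 1 then (if w ∈ insert w K then (a : ℝ) else 0) + φ (insert w K)
        else 0) := by
    calc ρ * (t.wb + a * t.cb : ℕ) = ρ * t.wb + a * (ρ * t.cb) := by push_cast; ring
      _ ≤ ∑ K ∈ G.indepFamily J (S \ R), (if #K = n then φ K else 0) +
          a * ∑ K ∈ G.indepFamily J (S \ R), (if #K = n then (1 : ℝ) else 0) := by
          rw [h2.count]
          exact add_le_add_left h2.weight _
      _ = _ := by
        rw [mul_sum, ← sum_add_distrib]
        refine sum_congr rfl fun K hK => ?_
        rw [card_insert_of_notMem (hwK' K hK), hφ]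
        by_cases hn : #K = n <;> simp [hn, add_comm]
  refine ⟨by simp, ?_, ?_⟩
  · intro K L hKL
    have e1 : w ∈ K ↔ w ∈ L := by
      have := congrArg (w ∈ ·) hKL
      simpa using this
    have e2 : K ∩ S = L ∩ S := by
      rw [← inter_eq_right.2 (subset_insert w S), ← inter_assoc, hKL, inter_assoc]
    simp only [e1, h.congr K L e2]
  · rw [hout]
    obtain ⟨s, cb, cf, wb, wf⟩ := t
    rcases s with _ | _ | s <;>
      simp only [ForestType.node, zero_add, add_zero] at h1 h2 hle hfree hin hinw ⊢
    · have h0 : ∀ K ∈ G.indepFamily J S, #K ≠ n + 1 := fun K hK => by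
        have := h1.card_le K hK
        omega
      refine ⟨n, ρ, hρ, ⟨hle _ (by simp) le_rfl, h2.pos, ?_, ?_⟩, hfree⟩
      · rw [sum_indepFamily_insert hwS hadj hJ, hin, add_eq_right]
        exact sum_eq_zero fun K hK => if_neg (h0 K hK)
      · rw [sum_indepFamily_insert hwS hadj hJ]
        refine hinw.trans_eq ?_
        rw [right_eq_add]
        exact sum_eq_zero fun K hK => if_neg (h0 K hK)
    · refine ⟨n + 1, ρ, hρ, ⟨hle _ (by simp) le_rfl, ?_, ?_, ?_⟩, hfree⟩
      · have := add_pos h1.pos h2.pos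
        simpa [mul_add] using this
      · rw [sum_indepFamily_insert hwS hadj hJ, hin, h1.count]
        push_cast
        ring
      · rw [sum_indepFamily_insert hwS hadj hJ, Nat.cast_add, mul_add]
        exact add_le_add hfree.weight hinw
    · have h0 : ∀ K ∈ G.indepFamily J (S \ R), #(insert w K) ≠ n + (s + 1 + 1) := fun K hK => by
        have := h2.card_le K hK
        rw [card_insert_of_notMem (hwK' K hK)]
        omega
      refine ⟨n + (s + 1 + 1), ρ, hρ, ⟨hle _ (by simp) (by simp), h1.pos, ?_, ?_⟩, hfree⟩
      · rw [sum_indepFamily_insert hwS hadj hJ, ← h1.count, add_eq_left]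
        exact sum_eq_zero fun K hK => if_neg (h0 K hK)
      · rw [sum_indepFamily_insert hwS hadj hJ]
        refine hfree.weight.trans_eq ?_
        rw [left_eq_add]
        exact sum_eq_zero fun K hK => if_neg (h0 K hK)

/-- Data matter only up to a common factor: replacing the scale `ρ` by `ρ * u.cf / t.cf` makes the
counts agree and can only lower the weights, which are lower bounds anyway. -/
theorem HasForestType.of_dominated {J S R : Finset V} {φ : Finset V → ℝ} {t u : ForestType}
    (h : HasForestType G J S R φ u) (htu : t.Dominated u) : HasForestType G J S R φ t := by
  obtain ⟨hs, hcf, hcb, hwb, hwf⟩ := htu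
  obtain ⟨n, ρ, hρ, h1, h2⟩ := h.isTop
  have hcf' : (0 : ℝ) < t.cf := by exact_mod_cast hcf
  have hcfu : (0 : ℝ) < u.cf := pos_of_mul_pos_right h1.pos hρ.le
  have e1 : ρ * u.cf / t.cf * t.cf = ρ * u.cf := by field_simp
  have e2 : ρ * u.cf / t.cf * t.cb = ρ * u.cb := by
    have : (t.cb : ℝ) * u.cf = u.cb * t.cf := by exact_mod_cast hcb
    field_simp
    linarith
  have e3 : ρ * u.cf / t.cf * t.wb ≤ ρ * u.wb := by
    have : (t.wb : ℝ) * u.cf ≤ u.wb * t.cf := by exact_mod_cast hwb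
    rw [div_mul_eq_mul_div, div_le_iff₀ hcf']
    nlinarith
  have e4 : ρ * u.cf / t.cf * t.wf ≤ ρ * u.wf := by
    have : (t.wf : ℝ) * u.cf ≤ u.wf * t.cf := by exact_mod_cast hwf
    rw [div_mul_eq_mul_div, div_le_iff₀ hcf']
    nlinarith
  refine ⟨h.subset, h.congr, n, ρ * u.cf / t.cf, by positivity, ?_, ?_⟩
  · rw [e1, hs]
    exact ⟨h1.card_le, h1.pos, h1.count, e4.trans h1.weight⟩
  · rw [e2]
    exact ⟨h2.card_le, h2.pos, h2.count, e3.trans h2.weight⟩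

end SimpleGraph

/-! ### Averaging over the maximum independent sets -/

namespace SimpleGraph

variable {V : Type*} [Fintype V] (G : SimpleGraph V)

theorem card_le_indepNum {G : SimpleGraph V} {I : Finset V}
    (h : ∀ a ∈ I, ∀ b ∈ I, ¬ G.Adj a b) : #I ≤ G.indepNum :=
  IsIndepSet.card_le_indepNum (fun a ha b hb _ => h a ha b hb)

theorem sum_sum_neighborFinset_comm {G : SimpleGraph V} [DecidableRel G.Adj] {d : ℕ}
    (hd : G.IsRegularOfDegree d) (f : V → ℝ) :
    ∑ u, ∑ w ∈ G.neighborFinset u, f w = d * ∑ w, f w := by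
  rw [sum_comm' (t' := univ) (s' := fun w => G.neighborFinset w) (by simp [adj_comm]), mul_sum]
  refine sum_congr rfl fun w _ => ?_
  rw [sum_const, card_neighborFinset_eq_degree, hd w, nsmul_eq_mul]

variable [DecidableEq V] [DecidableRel G.Adj]

/-- The maximum independent sets. -/
noncomputable def maxIndepSets : Finset (Finset V) :=
  {I | (∀ a ∈ I, ∀ b ∈ I, ¬ G.Adj a b) ∧ #I = G.indepNum}

variable {G}

theorem maxIndepSets_nonempty : G.maxIndepSets.Nonempty := by
  obtain ⟨s, hs⟩ := G.exists_isNIndepSet_indepNum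
  refine ⟨s, by
    simp only [maxIndepSets, mem_filter, mem_univ, true_and]
    refine ⟨fun a ha b hb hab => ?_, hs.card_eq⟩
    exact hs.isIndepSet ha hb hab.ne hab⟩

/-- If, whatever the outside of `S`, the largest extensions into `S` have average weight at least
`D`, then so do the maximum independent sets. -/
theorem mul_card_maxIndepSets_le {S : Finset V} {φ : Finset V → ℝ} {D : ℝ}
    (hφ : ∀ K L : Finset V, K ∩ S = L ∩ S → φ K = φ L)
    (h : ∀ J : Finset V, Disjoint J S →
      ∃ (n : ℕ) (c w : ℝ), IsTop (G.indepFamily J S) φ n c w ∧ D * c ≤ w) :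
    D * #G.maxIndepSets ≤ ∑ I ∈ G.maxIndepSets, φ I := by
  suffices 0 ≤ ∑ I ∈ G.maxIndepSets, (φ I - D) by
    rw [sum_sub_distrib, sum_const, nsmul_eq_mul] at this
    linarith
  -- Conditioning on the part outside `S`: each fibre is shown to have a nonnegative sum.
  rw [← sum_fiberwise_of_maps_to (t := G.maxIndepSets.image (· \ S))
    (fun I hI => mem_image_of_mem _ hI)]
  refine sum_nonneg fun J hJ => ?_
  obtain ⟨I₀, hI₀, rfl⟩ := mem_image.1 hJ
  simp only [maxIndepSets, mem_filter, mem_univ, true_and] at hI₀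
  set J := I₀ \ S with hJdef
  have hJS : Disjoint J S := sdiff_disjoint
  obtain ⟨n, c, w, htop, hDw⟩ := h J hJS
  have hext : ∀ K ∈ G.indepFamily J S, ∀ a ∈ J ∪ K, ∀ b ∈ J ∪ K, ¬ G.Adj a b := by
    intro K hK a ha b hb hab
    obtain ⟨-, h1, h2⟩ := mem_indepFamily.1 hK
    rcases mem_union.1 ha with ha | ha <;> rcases mem_union.1 hb with hb | hb
    · exact hI₀.1 a (mem_sdiff.1 ha).1 b (mem_sdiff.1 hb).1 hab
    · exact h2 b hb a ha hab.symm
    · exact h2 a ha b hb hab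
    · exact h1 a ha b hb hab
  have hcard : ∀ K ∈ G.indepFamily J S, #(J ∪ K) = #J + #K := fun K hK =>
    card_union_of_disjoint (hJS.mono_right (mem_indepFamily.1 hK).1)
  have htrace : ∀ I ∈ G.maxIndepSets, I \ S = J → I ∩ S ∈ G.indepFamily J S := by
    intro I hI hIJ
    simp only [maxIndepSets, mem_filter, mem_univ, true_and] at hI
    refine mem_indepFamily.2 ⟨inter_subset_right, fun a ha b hb =>
      hI.1 a (mem_inter.1 ha).1 b (mem_inter.1 hb).1, fun a ha b hb => ?_⟩
    rw [← hIJ] at hb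
    exact hI.1 a (mem_inter.1 ha).1 b (mem_sdiff.1 hb).1
  -- A largest extension cannot exceed the independence number, and the trace of `I₀` shows that it
  -- reaches it. So the fibre over `J` consists precisely of `J` joined with the largest extensions.
  have hn : #J + n = G.indepNum := by
    apply le_antisymm
    · have : ∃ K ∈ G.indepFamily J S, #K = n := by
        by_contra! hne
        have h0 := htop.count
        rw [sum_eq_zero fun K hK => if_neg (hne K hK)] at h0
        exact htop.pos.ne h0
      obtain ⟨K, hK, rfl⟩ := this
      rw [← hcard K hK]
      exact card_le_indepNum (hext K hK)
    · have h1 := htop.card_le _ (htrace I₀ (by simpa [maxIndepSets] using hI₀) rfl)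
      have h2 : #(I₀ \ S) + #(I₀ ∩ S) = #I₀ := card_sdiff_add_card_inter I₀ S
      rw [← hJdef] at h2
      omega
  have hfib : ∑ I ∈ G.maxIndepSets with I \ S = J, (φ I - D) =
      ∑ K ∈ G.indepFamily J S with #K = n, (φ K - D) := by
    refine sum_nbij' (fun I => I ∩ S) (fun K => J ∪ K) ?_ ?_ ?_ ?_ ?_
    · intro I hI
      obtain ⟨hI, hIJ⟩ := mem_filter.1 hI
      refine mem_filter.2 ⟨htrace I hI hIJ, ?_⟩
      simp only [maxIndepSets, mem_filter, mem_univ, true_and] at hI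
      have h2 : #(I \ S) + #(I ∩ S) = #I := card_sdiff_add_card_inter I S
      rw [hIJ] at h2
      omega
    · intro K hK
      obtain ⟨hK, hKn⟩ := mem_filter.1 hK
      refine mem_filter.2 ⟨?_, ?_⟩
      · simp only [maxIndepSets, mem_filter, mem_univ, true_and]
        exact ⟨hext K hK, by rw [hcard K hK, hKn, hn]⟩
      · rw [union_sdiff_distrib, sdiff_eq_self_of_disjoint hJS,
          sdiff_eq_empty_iff_subset.2 (mem_indepFamily.1 hK).1, union_empty]
    · intro I hI
      obtain ⟨-, hIJ⟩ := mem_filter.1 hI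
      simp only [← hIJ]
      exact sdiff_union_inter I S
    · intro K hK
      obtain ⟨hK, -⟩ := mem_filter.1 hK
      rw [union_inter_distrib_right, disjoint_iff_inter_eq_empty.1 hJS, empty_union,
        inter_eq_left.2 (mem_indepFamily.1 hK).1]
    · intro I _
      rw [hφ I (I ∩ S) (by rw [inter_assoc, inter_self])]
  rw [hfib, sum_sub_distrib, sum_filter, sum_const, nsmul_eq_mul, ← sum_boole, htop.count]
  have := htop.weight
  linarith [mul_comm D c]

variable (G) in
/-- The weight of `K` on the branch at `w` that points away from `u`, if the vertices at distance
`i` from `w` have the weight `l[i]`. -/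
def branchWeight : List ℕ → V → V → Finset V → ℝ
  | [], _, _, _ => 0
  | a :: l, u, w, K => (if w ∈ K then (a : ℝ) else 0) +
      ∑ x ∈ (G.neighborFinset w).erase u, branchWeight l w x K

/-- The total weight of a branch in a `d`-regular graph. -/
def totalWeight (d : ℕ) : List ℕ → ℕ
  | [] => 0
  | a :: l => a + (d - 1) * totalWeight d l

/-- In the sum over directed edges, each directed edge `(w, x)` continues exactly `d - 1` directed
edges `(u, w)`, so each further level contributes a factor `d - 1`. Only regularity is involved,
since non-backtracking walks are counted with multiplicity. -/
theorem sum_branchWeight {d : ℕ} (hd : G.IsRegularOfDegree d) (l : List ℕ) (K : Finset V) :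
    ∑ u, ∑ w ∈ G.neighborFinset u, G.branchWeight l u w K = d * totalWeight d l * #K := by
  induction l with
  | nil => simp [branchWeight, totalWeight]
  | cons a l ih =>
    simp only [branchWeight, sum_add_distrib]
    rw [sum_sum_neighborFinset_comm hd fun w => if w ∈ K then (a : ℝ) else 0]
    have h1 : ∑ u, ∑ w ∈ G.neighborFinset u, ∑ x ∈ (G.neighborFinset w).erase u,
        G.branchWeight l w x K =
        ∑ w, ∑ x ∈ G.neighborFinset w, ((d - 1 : ℕ) : ℝ) * G.branchWeight l w x K := by
      rw [sum_comm' (t' := univ) (s' := fun w => G.neighborFinset w) (by simp [adj_comm])]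
      refine sum_congr rfl fun w _ => ?_
      rw [sum_comm' (t' := G.neighborFinset w) (s' := fun x => (G.neighborFinset w).erase x)
        (by simp only [mem_erase, mem_neighborFinset]; tauto)]
      refine sum_congr rfl fun x hx => ?_
      rw [sum_const, card_erase_of_mem hx, card_neighborFinset_eq_degree, hd w, nsmul_eq_mul]
    rw [h1]
    simp only [← mul_sum]
    rw [ih, sum_ite_mem, univ_inter, sum_const, nsmul_eq_mul, totalWeight]
    push_cast
    ring

end SimpleGraph

/-! ### Finite enumeration of branch data -/

namespace ForestType

/-- Some member of the list is at most as favourable as `u`. -/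
def covers (L : List ForestType) (u : ForestType) : Bool :=
  L.any fun t => Nat.beq t.s u.s && Nat.blt 0 t.cf &&
    Nat.beq (Nat.mul t.cb u.cf) (Nat.mul u.cb t.cf) &&
    Nat.ble (Nat.mul t.wb u.cf) (Nat.mul u.wb t.cf) &&
    Nat.ble (Nat.mul t.wf u.cf) (Nat.mul u.wf t.cf)

theorem exists_dominated_of_covers {L : List ForestType} {u : ForestType} (h : covers L u = true) :
    ∃ t ∈ L, t.Dominated u := by
  obtain ⟨t, ht, h⟩ := List.any_eq_true.1 h
  simp only [Bool.and_eq_true, Nat.beq_eq, Nat.ble_eq, Nat.blt_eq] at h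
  exact ⟨t, ht, h.1.1.1.1, h.1.1.1.2, h.1.1.2, h.1.2, h.2⟩

/-- Apply `f` to all nonempty suffixes of a list after multiplying by their heads. -/
def allTails (f : List ForestType → ForestType → Bool) : List ForestType → ForestType → Bool
  | [], _ => true
  | t :: ts, u => f (t :: ts) (u * t) && allTails f ts u

/-- Test `p` on the products of `u` with any `n` members of a list. -/
def allProducts (p : ForestType → Bool) : ℕ → List ForestType → ForestType → Bool
  | 0 => fun _ u => p u
  | n + 1 => allTails (allProducts p n)

/-- The head of the list is either used, and stays available for repetition, or discarded for good.
Thus every multiset is met without running through its orderings. -/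
theorem of_allProducts {p : ForestType → Bool} {n : ℕ} {L : List ForestType} {u : ForestType}
    (h : allProducts p n L u = true) {m : Multiset ForestType} (hm : m.card = n)
    (hL : ∀ t ∈ m, t ∈ L) : p (u * m.prod) = true := by
  induction n generalizing L u m with
  | zero =>
    obtain rfl := Multiset.card_eq_zero.1 hm
    simpa [allProducts] using h
  | succ n ih =>
    induction L with
    | nil =>
      obtain ⟨t, ht⟩ := Multiset.card_pos_iff_exists_mem.1 (by omega : 0 < m.card)
      exact absurd (hL t ht) (by simp)
    | cons t ts ih' =>
      simp only [allProducts, allTails, Bool.and_eq_true] at h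
      by_cases ht : t ∈ m
      · obtain ⟨m', rfl⟩ := Multiset.exists_cons_of_mem ht
        rw [Multiset.prod_cons, ← mul_assoc]
        exact ih h.1 (by simpa using hm) fun t' ht' => hL t' (Multiset.mem_cons_of_mem ht')
      · refine ih' h.2 fun t' ht' => ?_
        rcases List.mem_cons.1 (hL t' ht') with rfl | h'
        · exact absurd ht' ht
        · exact h'

/-- After adding a root of weight `a`, the average weight is at least `D`. -/
def rootOK (D a : ℕ) : ForestType → Bool
  | ⟨0, cb, _, wb, _⟩ => Nat.ble (Nat.mul D cb) (Nat.add wb (Nat.mul a cb))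
  | ⟨1, cb, cf, wb, wf⟩ =>
    Nat.ble (Nat.mul D (Nat.add cf cb)) (Nat.add wf (Nat.add wb (Nat.mul a cb)))
  | ⟨_ + 2, _, cf, _, wf⟩ => Nat.ble (Nat.mul D cf) wf

theorem rootOK_iff {D a : ℕ} {t : ForestType} :
    rootOK D a t = true ↔ D * (t.node a).cf ≤ (t.node a).wf := by
  obtain ⟨s, cb, cf, wb, wf⟩ := t
  rcases s with _ | _ | s <;> simp only [rootOK, Nat.ble_eq] <;> exact Iff.rfl

/-- Every branch in a `d`-regular graph whose levels have the weights `l` has data in `L`, up to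
domination. -/
inductive IsComplete (d : ℕ) : List ℕ → List ForestType → Prop
  | leaf (a : ℕ) : IsComplete d [a] [⟨1, 1, 1, 0, a⟩, 1]
  | cons {l : List ℕ} {L : List ForestType} (a : ℕ) (L' : List ForestType)
      (h : allProducts (fun u => covers L' (u.node a)) (d - 1) L 1 = true)
      (hL : IsComplete d l L) : IsComplete d (a :: l) L'

end ForestType

/-! ### Data of the branches of a regular graph -/

namespace SimpleGraph

open ForestType

variable {V : Type*} [Fintype V] [DecidableEq V] {G : SimpleGraph V} [DecidableRel G.Adj]

/-- A vertex with branches of several depths. -/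
theorem hasForestType_node {J : Finset V} {w : V} {C : Finset V} (hC : ∀ x ∈ C, G.Adj w x)
    {m : V → ℕ} {φ : V → Finset V → ℝ} {t : V → ForestType}
    (h : ∀ x ∈ C, HasForestType G J (G.branch (m x) w x) {x} (φ x) (t x))
    (hJ : ∀ b ∈ J, ¬ G.Adj w b)
    (hgirth : ∀ x ∈ C, ∀ y ∈ C, x ≠ y → ((m x + m y + 1 : ℕ) : ℕ∞) < G.egirth)
    (hgirth' : ∀ x ∈ C, ((m x + 1 : ℕ) : ℕ∞) < G.egirth) (a : ℕ) :
    HasForestType G J (insert w (C.biUnion fun x => G.branch (m x) w x)) {w}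
      (fun K => (if w ∈ K then (a : ℝ) else 0) + ∑ x ∈ C, φ x K) ((∏ x ∈ C, t x).node a) := by
  refine (HasForestType.prod C h ?_ ?_).node ?_ ?_ hJ a
  · exact fun x hx y hy hxy => disjoint_branch
      (lt_of_le_of_lt (by exact_mod_cast Nat.le_succ _) (hgirth x hx y hy hxy)) (hC x hx) (hC y hy)
      hxy
  · exact fun x hx y hy hxy _ ha _ hb =>
      not_adj_branch (hgirth x hx y hy hxy) (hC x hx) (hC y hy) hxy ha hb
  · simp only [mem_biUnion, not_exists, not_and]
    exact fun x hx => notMem_branch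
      (lt_of_le_of_lt (by exact_mod_cast Nat.le_succ _) (hgirth' x hx)) (hC x hx)
  · intro y hy
    obtain ⟨x, hx, hy⟩ := mem_biUnion.1 hy
    simp only [mem_biUnion, mem_singleton]
    constructor
    · intro hwy
      exact ⟨x, hx, eq_root_of_adj_of_mem_branch (hgirth' x hx) (hC x hx) hy hwy⟩
    · rintro ⟨z, hz, rfl⟩
      exact hC _ hz

/-- The outside set enters the recursion only here: a leaf is either free or forbidden by a
neighbour in `J`. -/
theorem hasForestType_leaf (J : Finset V) (u w : V) (a : ℕ) :
    ∃ t ∈ [(⟨1, 1, 1, 0, a⟩ : ForestType), 1],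
      HasForestType G J (G.branch 1 u w) {w} (G.branchWeight [a] u w) t := by
  have hS : G.branch 1 u w = {w} := by
    ext y
    simp [branch]
  have hφ : G.branchWeight [a] u w = fun K => if w ∈ K then (a : ℝ) else 0 := by
    ext K
    simp [branchWeight]
  rw [hS, hφ]
  have hcongr : ∀ K L : Finset V, K ∩ {w} = L ∩ {w} →
      (if w ∈ K then (a : ℝ) else 0) = if w ∈ L then (a : ℝ) else 0 := by
    intro K L hKL
    have : w ∈ K ↔ w ∈ L := by simpa using congrArg (w ∈ ·) hKL
    simp [this]
  by_cases hJ : ∀ b ∈ J, ¬ G.Adj w b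
  · refine ⟨⟨1, 1, 1, 0, a⟩, by simp, ?_⟩
    have := (HasForestType.empty (G := G) J).node (notMem_empty w) (by simp) hJ a
    simpa [ForestType.node, show (1 : ForestType) = ⟨0, 1, 1, 0, 0⟩ from rfl] using this
  · refine ⟨1, by simp, subset_rfl, hcongr, 0, 1, one_pos, ?_⟩
    have hF : G.indepFamily J {w} = {∅} := by
      ext K
      rw [mem_indepFamily, subset_singleton_iff, mem_singleton]
      constructor
      · rintro ⟨rfl | rfl, -, h⟩
        · rfl
        · exact absurd (h w (mem_singleton_self w)) hJ
      · rintro rfl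
        simp
    rw [hF, sdiff_self, bot_eq_empty, indepFamily_empty]
    constructor <;> constructor <;> simp

/-- Each of the `d - 1` children has data from the list of the previous level; their product
followed by `node` is one of the finitely many cases covered by the certificate. -/
theorem exists_hasForestType {d : ℕ} (hd : G.IsRegularOfDegree d) {l : List ℕ}
    {L : List ForestType} (hL : IsComplete d l L)
    (hg : ((2 * l.length : ℕ) : ℕ∞) ≤ G.egirth) {J : Finset V} {u w : V} (huw : G.Adj u w)
    (huJ : u ∉ J) (hJ : Disjoint J (G.branch l.length u w)) :
    ∃ t ∈ L, HasForestType G J (G.branch l.length u w) {w} (G.branchWeight l u w) t := by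
  induction hL generalizing u w with
  | leaf a => exact hasForestType_leaf J u w a
  | @cons l L a L' h hL ih =>
    have hl : 0 < l.length := by cases hL <;> simp
    have hg' : ∀ k : ℕ, k < 2 * (l.length + 1) → (k : ℕ∞) < G.egirth := fun k hk =>
      lt_of_lt_of_le (by exact_mod_cast hk) hg
    have hsub : ∀ x ∈ (G.neighborFinset w).erase u, G.branch l.length w x ⊆
        G.branch (l.length + 1) u w := fun x hx =>
      (subset_biUnion_of_mem (fun x => G.branch l.length w x) hx).trans (subset_insert _ _)
    have hwJ : w ∉ J := fun h => (Finset.disjoint_left.1 hJ h) (root_mem_branch _ _ _)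
    have hadj : ∀ x ∈ (G.neighborFinset w).erase u, G.Adj w x := fun x hx => by
      simpa using mem_of_mem_erase hx
    have hex : ∀ x : V, ∃ t : ForestType, x ∈ (G.neighborFinset w).erase u → t ∈ L ∧
        HasForestType G J (G.branch l.length w x) {x} (G.branchWeight l w x) t := by
      intro x
      by_cases hx : x ∈ (G.neighborFinset w).erase u
      · obtain ⟨t, ht, h⟩ := ih (le_trans (by exact_mod_cast (by simp)) hg) (hadj x hx) hwJ
          (hJ.mono_right (hsub x hx))
        exact ⟨t, fun _ => ⟨ht, h⟩⟩
      · exact ⟨1, fun h => absurd h hx⟩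
    choose t ht using hex
    have hnode := hasForestType_node (J := J) (w := w) (C := (G.neighborFinset w).erase u)
      (m := fun _ => l.length) hadj (fun x hx => (ht x hx).2) ?_
      (fun x _ y _ _ => hg' _ (by omega)) (fun x _ => hg' _ (by omega)) a
    · have hcov := of_allProducts h (m := ((G.neighborFinset w).erase u).val.map t) (by
        rw [Multiset.card_map, card_val, card_erase_of_mem (by simpa using huw.symm),
          card_neighborFinset_eq_degree, hd w]) (by
        intro s hs
        obtain ⟨x, hx, rfl⟩ := Multiset.mem_map.1 hs
        exact (ht x hx).1)
      rw [one_mul] at hcov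
      obtain ⟨t', ht', hdom⟩ := exists_dominated_of_covers hcov
      exact ⟨t', ht', hnode.of_dominated hdom⟩
    -- An inner vertex is never forbidden by `J`: its neighbours are the parent `u` and the roots of
    -- its sub-branches, all outside `J`.
    · intro b hb hwb
      by_cases hbu : b = u
      · exact huJ (hbu ▸ hb)
      · have hbC : b ∈ (G.neighborFinset w).erase u := by simp [hbu, hwb]
        refine Finset.disjoint_left.1 hJ hb (hsub b hbC ?_)
        obtain ⟨k, hk⟩ := Nat.exists_eq_succ_of_ne_zero hl.ne'
        rw [hk]
        exact root_mem_branch _ _ _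

end SimpleGraph

/-! ### From local inequalities at vertices and edges to global bounds -/

namespace SimpleGraph

open ForestType

theorem disjoint_root {V : Type*} [DecidableEq V] {G : SimpleGraph V} {J : Finset V} {v : V} {C : Finset V} {S : V → Finset V}
    (hC : ∀ x, G.Adj v x → x ∈ C) (hS : ∀ x ∈ C, x ∈ S x)
    (hJ : Disjoint J (insert v (C.biUnion S))) :
    v ∉ J ∧ (∀ x ∈ C, Disjoint J (S x)) ∧ ∀ b ∈ J, ¬ G.Adj v b := by
  rw [disjoint_insert_right, disjoint_biUnion_right] at hJ
  exact ⟨hJ.1, hJ.2, fun b hb hvb =>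
    Finset.disjoint_left.1 (hJ.2 b (hC b hvb)) hb (hS b (hC b hvb))⟩

variable {V : Type*} [Fintype V] [DecidableEq V] {G : SimpleGraph V} [DecidableRel G.Adj]

/-- If the local weights `φ i` all have average at least `D` over the maximum independent sets and
add up to `T` times the size of the set, then `D` times the number of local weights is at most
`T` times the independence number. -/
theorem card_mul_le_of_average {ι : Type*} (s : Finset ι) {φ : ι → Finset V → ℝ} {D T : ℝ}
    (h : ∀ i ∈ s, D * #G.maxIndepSets ≤ ∑ I ∈ G.maxIndepSets, φ i I)
    (hT : ∀ I ∈ G.maxIndepSets, ∑ i ∈ s, φ i I = T * #I) :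
    D * #s ≤ T * G.indepNum := by
  have h1 : ∑ i ∈ s, D * #G.maxIndepSets ≤ ∑ i ∈ s, ∑ I ∈ G.maxIndepSets, φ i I :=
    sum_le_sum h
  rw [sum_comm, sum_congr rfl hT, sum_const, nsmul_eq_mul,
    sum_congr rfl (g := fun _ => T * (G.indepNum : ℝ)) (fun I hI => by
      rw [(mem_filter.1 hI).2.2]), sum_const, nsmul_eq_mul] at h1
  have h2 : (0 : ℝ) < #G.maxIndepSets := by exact_mod_cast maxIndepSets_nonempty.card_pos
  refine le_of_mul_le_mul_left ?_ h2
  linarith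

theorem average_of_hasForestType {S R : Finset V} {φ : Finset V → ℝ} {D a : ℕ}
    (h : ∀ J : Finset V, Disjoint J S → ∃ t : ForestType, rootOK D a t = true ∧
      HasForestType G J S R φ (t.node a)) :
    (D : ℝ) * #G.maxIndepSets ≤ ∑ I ∈ G.maxIndepSets, φ I := by
  refine mul_card_maxIndepSets_le (S := S) ?_ fun J hJ => ?_
  · obtain ⟨t, -, ht⟩ := h ∅ (disjoint_empty_left _)
    exact ht.congr
  · obtain ⟨t, hok, ht⟩ := h J hJ
    obtain ⟨n, ρ, hρ, htop, -⟩ := ht.isTop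
    refine ⟨_, _, _, htop, ?_⟩
    have : (D : ℝ) * (t.node a).cf ≤ (t.node a).wf := by exact_mod_cast rootOK_iff.1 hok
    nlinarith

theorem root_mem_branch_of_pos {m : ℕ} (hm : 0 < m) (u w : V) : w ∈ G.branch m u w := by
  obtain ⟨k, rfl⟩ := Nat.exists_eq_succ_of_ne_zero hm.ne'
  exact root_mem_branch _ _ _

theorem _root_.ForestType.IsComplete.length_pos {d : ℕ} {l : List ℕ} {L : List ForestType}
    (h : IsComplete d l L) : 0 < l.length := by
  cases h <;> simp

/-- The bound obtained from the balls around the vertices. -/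
theorem mul_card_le_of_vertex_check {d : ℕ} (hd : G.IsRegularOfDegree d) {D a : ℕ} {l : List ℕ}
    {L : List ForestType} (hL : IsComplete d l L)
    (hroot : ∀ m : Multiset ForestType, m.card = d → (∀ t ∈ m, t ∈ L) →
      rootOK D a m.prod = true)
    (hg : ((2 * l.length + 2 : ℕ) : ℕ∞) ≤ G.egirth) :
    (D : ℝ) * Fintype.card V ≤ (a + d * totalWeight d l : ℕ) * G.indepNum := by
  have hg' : ∀ k : ℕ, k < 2 * l.length + 2 → (k : ℕ∞) < G.egirth := fun k hk =>
    lt_of_lt_of_le (by exact_mod_cast hk) hg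
  refine card_mul_le_of_average univ (φ := fun v K => (if v ∈ K then (a : ℝ) else 0) +
    ∑ x ∈ G.neighborFinset v, G.branchWeight l v x K) (fun v _ => ?_) fun I _ => ?_
  · refine average_of_hasForestType (D := D) (a := a)
      (S := insert v ((G.neighborFinset v).biUnion fun x => G.branch l.length v x)) (R := {v})
      fun J hJ => ?_
    obtain ⟨hvJ, hJb, hJv⟩ := disjoint_root (G := G) (fun x hx => by simpa using hx)
      (fun x _ => root_mem_branch_of_pos hL.length_pos v x) hJ
    have hex : ∀ x : V, ∃ t : ForestType, x ∈ G.neighborFinset v → t ∈ L ∧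
        HasForestType G J (G.branch l.length v x) {x} (G.branchWeight l v x) t := by
      intro x
      by_cases hx : x ∈ G.neighborFinset v
      · obtain ⟨t, ht, h⟩ := exists_hasForestType hd hL
          (le_trans (by exact_mod_cast (by omega)) hg) (by simpa using hx) hvJ (hJb x hx)
        exact ⟨t, fun _ => ⟨ht, h⟩⟩
      · exact ⟨1, fun h => absurd h hx⟩
    choose t ht using hex
    refine ⟨_, hroot ((G.neighborFinset v).val.map t) ?_ ?_, hasForestType_node
      (m := fun _ => l.length) (fun x hx => by simpa using hx) (fun x hx => (ht x hx).2) hJv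
      (fun _ _ _ _ _ => hg' _ (by omega)) (fun _ _ => hg' _ (by omega)) a⟩
    · rw [Multiset.card_map, card_val, card_neighborFinset_eq_degree, hd v]
    · intro s hs
      obtain ⟨x, hx, rfl⟩ := Multiset.mem_map.1 hs
      exact (ht x hx).1
  · rw [sum_add_distrib, sum_branchWeight hd, sum_ite_mem, univ_inter, sum_const, nsmul_eq_mul]
    push_cast
    ring

/-- The bound obtained from the balls around the edges. -/
theorem mul_card_le_of_edge_check {d : ℕ} (hd : G.IsRegularOfDegree d) (hd0 : 0 < d) {D a : ℕ}
    {l : List ℕ} {L L' : List ForestType} (hL : IsComplete d l L) (hL' : IsComplete d (a :: l) L')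
    (hroot : ∀ m : Multiset ForestType, m.card = d - 1 → (∀ t ∈ m, t ∈ L) → ∀ t ∈ L',
      rootOK D a (t * m.prod) = true)
    (hg : ((2 * l.length + 3 : ℕ) : ℕ∞) ≤ G.egirth) :
    (D : ℝ) * Fintype.card V ≤ (2 * totalWeight d (a :: l) : ℕ) * G.indepNum := by
  have hg' : ∀ k : ℕ, k < 2 * l.length + 3 → (k : ℕ∞) < G.egirth := fun k hk =>
    lt_of_lt_of_le (by exact_mod_cast hk) hg
  -- The places are the directed edges, `d` per vertex; the factor `d` cancels at the end.
  have key := card_mul_le_of_average (G := G) (D := D) (T := d * (2 * totalWeight d (a :: l) : ℕ))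
    (univ.sigma fun u => G.neighborFinset u)
    (φ := fun e K => G.branchWeight (a :: l) e.2 e.1 K + G.branchWeight (a :: l) e.1 e.2 K)
    (fun e he => ?_) fun I _ => ?_
  · have hcard : (#(univ.sigma fun u => G.neighborFinset u) : ℝ) = d * Fintype.card V := by
      rw [card_sigma]
      simp [hd _, mul_comm]
    rw [hcard] at key
    have hd0' : (0 : ℝ) < d := by exact_mod_cast hd0
    refine le_of_mul_le_mul_left ?_ hd0'
    linarith
  · obtain ⟨v, w⟩ := e
    have hvw : G.Adj v w := by simpa using he
    have hwN : w ∈ G.neighborFinset v := by simpa using hvw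
    -- The ball around the edge `vw` is viewed as a tree rooted at `v` in which the branch at `w` is
    -- one level deeper than the others.
    let m : V → ℕ := fun x => if x = w then l.length + 1 else l.length
    let φ : V → Finset V → ℝ := fun x =>
      if x = w then G.branchWeight (a :: l) v w else G.branchWeight l v x
    have hmpos : ∀ x, 0 < m x := fun x => by
      have := hL.length_pos
      by_cases hx : x = w <;> simp [m, hx, this]
    have hmle : ∀ x, m x ≤ l.length + 1 := fun x => by
      by_cases hx : x = w <;> simp [m, hx]
    have hφ : (fun K => G.branchWeight (a :: l) w v K + G.branchWeight (a :: l) v w K) =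
        fun K => (if v ∈ K then (a : ℝ) else 0) + ∑ x ∈ G.neighborFinset v, φ x K := by
      ext K
      rw [← sum_erase_add _ _ hwN, branchWeight, add_assoc]
      congr 2
      · refine sum_congr rfl fun x hx => ?_
        simp [φ, ne_of_mem_erase hx]
      · simp [φ]
    simp only
    rw [hφ]
    refine average_of_hasForestType (D := D) (a := a)
      (S := insert v ((G.neighborFinset v).biUnion fun x => G.branch (m x) v x)) (R := {v})
      fun J hJ => ?_
    obtain ⟨hvJ, hJb, hJv⟩ := disjoint_root (G := G) (fun x hx => by simpa using hx)
      (fun x _ => root_mem_branch_of_pos (hmpos x) v x) hJ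
    have hex : ∀ x : V, ∃ t : ForestType, x ∈ G.neighborFinset v →
        (if x = w then t ∈ L' else t ∈ L) ∧
        HasForestType G J (G.branch (m x) v x) {x} (φ x) t := by
      intro x
      by_cases hx : x ∈ G.neighborFinset v
      · have hJx := hJb x hx
        by_cases hxw : x = w
        · subst hxw
          simp only [m, φ, if_true] at hJx ⊢
          obtain ⟨t, ht, h⟩ := exists_hasForestType hd hL'
            (le_trans (by simp only [List.length_cons]; exact_mod_cast (by omega)) hg)
            hvw hvJ hJx
          exact ⟨t, fun _ => ⟨ht, h⟩⟩
        · simp only [m, φ, if_neg hxw] at hJx ⊢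
          obtain ⟨t, ht, h⟩ := exists_hasForestType hd hL
            (le_trans (by exact_mod_cast (by omega)) hg) (by simpa using hx) hvJ hJx
          exact ⟨t, fun _ => ⟨ht, h⟩⟩
      · exact ⟨1, fun h => absurd h hx⟩
    choose t ht using hex
    refine ⟨∏ x ∈ G.neighborFinset v, t x, ?_, hasForestType_node
      (m := m) (fun x hx => by simpa using hx) (fun x hx => (ht x hx).2) hJv
      (fun x _ y _ hxy => hg' _ ?_) (fun x _ => hg' _ ?_) a⟩
    · rw [← mul_prod_erase _ _ hwN]
      refine hroot (((G.neighborFinset v).erase w).val.map t) ?_ ?_ (t w) ?_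
      · rw [Multiset.card_map, card_val, card_erase_of_mem hwN, card_neighborFinset_eq_degree, hd v]
      · intro s hs
        obtain ⟨x, hx, rfl⟩ := Multiset.mem_map.1 hs
        have := (ht x (mem_of_mem_erase hx)).1
        rwa [if_neg (ne_of_mem_erase hx)] at this
      · simpa using (ht w hwN).1
    -- Only `w` carries the deeper branch, so two different branches have total depth at most `2 *
    -- l.length + 1`; this is why an odd girth bound suffices.
    · by_cases hx : x = w
      · have : y ≠ w := fun h => hxy (hx.trans h.symm)
        simp only [m, if_neg this]
        have := hmle x
        simp only [m] at this
        omega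
      · simp only [m, if_neg hx]
        have := hmle y
        simp only [m] at this
        omega
    · have := hmle x
      have := hL.length_pos
      omega
  · simp only [sum_add_distrib]
    have h1 : ∑ e ∈ univ.sigma fun u => G.neighborFinset u, G.branchWeight (a :: l) e.2 e.1 I =
        ∑ e ∈ univ.sigma fun u => G.neighborFinset u, G.branchWeight (a :: l) e.1 e.2 I := by
      refine sum_nbij' (fun e => ⟨e.2, e.1⟩) (fun e => ⟨e.2, e.1⟩) ?_ ?_ ?_ ?_ ?_ <;>
        simp [adj_comm]
    rw [h1, sum_sigma, sum_branchWeight hd]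
    push_cast
    ring

end SimpleGraph

/-! ### Girth six: a weight with local transfers -/

namespace ForestType

/-- The data of the three kinds of branches of depth two: the neighbours of the root at which none,
one, or at least two further vertices are available. -/
def cherryTypes (B C : ℕ) : List ForestType :=
  [⟨1, 1, 1, 0, B + C⟩, ⟨0, 1, 2, 0, B + C⟩, ⟨0, 1, 1, 0, C⟩]

/-- The local inequality for `cherryWeight`. -/
def cherryOK (D C d : ℕ) : ForestType → Bool
  | ⟨0, _, _, _, _⟩ => true
  | ⟨1, cb, cf, _, wf⟩ => Nat.ble ((D + d * C) * cf) (wf + C * (d - 1) * cb)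
  | ⟨_ + 2, _, cf, _, wf⟩ => Nat.ble ((D + d * C) * cf) wf

end ForestType

namespace SimpleGraph

open ForestType

variable {V : Type*} [Fintype V] [DecidableEq V] (G : SimpleGraph V) [DecidableRel G.Adj]

/-- The contribution of the neighbour `x` of `v` to `cherryWeight`. -/
def cherryBranchWeight (B C : ℕ) (v x : V) (K : Finset V) : ℝ :=
  if x ∈ K then (B + C : ℝ) else if #((G.neighborFinset x).erase v ∩ K) = 1 then 0 else C

/-- A weight in which each vertex outside `K` with exactly one neighbour in `K` receives `C` from
each of its neighbours outside `K` with several neighbours in `K`. -/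
def cherryWeight (B C D d : ℕ) (v : V) (K : Finset V) : ℝ :=
  if v ∈ K then (D : ℝ) else ∑ x ∈ G.neighborFinset v, G.cherryBranchWeight B C v x K - d * C +
    if #(G.neighborFinset v ∩ K) = 1 then (C : ℝ) * (d - 1 : ℕ) else 0

variable {G}

theorem branch_two (v x : V) :
    G.branch 2 v x = insert x ((G.neighborFinset x).erase v) := by
  ext y
  simp [branch]

/-- Each vertex of `I` gives `B` to each of its `d` neighbours, all outside `I`. The charges `C`
cancel: a vertex outside `I` with exactly one neighbour in `I` gains `C * (d - 1)`, and each of its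
`d - 1` neighbours outside `I` loses `C`. -/
theorem sum_cherryWeight {d : ℕ} (hd : G.IsRegularOfDegree d) (B C D : ℕ) {I : Finset V}
    (hI : ∀ a ∈ I, ∀ b ∈ I, ¬ G.Adj a b) :
    ∑ v, G.cherryWeight B C D d v I = (D + B * d : ℕ) * #I := by
  let f : V → ℝ := fun x =>
    if x ∈ I then (B : ℝ) else if #(G.neighborFinset x ∩ I) = 1 then -(C : ℝ) else 0
  have h0 : ∀ v ∈ I, G.cherryWeight B C D d v I = D := fun v hv => if_pos hv
  have h1 : ∀ v ∉ I, G.cherryWeight B C D d v I = ∑ x ∈ G.neighborFinset v, f x +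
      if #(G.neighborFinset v ∩ I) = 1 then (C : ℝ) * (d - 1 : ℕ) else 0 := by
    intro v hv
    rw [cherryWeight, if_neg hv]
    congr 1
    have : (d * C : ℝ) = ∑ x ∈ G.neighborFinset v, (C : ℝ) := by
      rw [sum_const, card_neighborFinset_eq_degree, hd v, nsmul_eq_mul]
    rw [this, ← sum_sub_distrib]
    refine sum_congr rfl fun x _ => ?_
    have he : (G.neighborFinset x).erase v ∩ I = G.neighborFinset x ∩ I := by
      ext y
      simp only [mem_inter, mem_erase]
      constructor
      · exact fun h => ⟨h.1.2, h.2⟩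
      · exact fun h => ⟨⟨fun e => hv (e ▸ h.2), h.1⟩, h.2⟩
    simp only [cherryBranchWeight, he, f]
    split_ifs <;> ring
  have h2 : ∑ v ∈ univ.filter (· ∉ I), ∑ x ∈ G.neighborFinset v, f x =
      ∑ x, (#(G.neighborFinset x \ I) : ℝ) * f x := by
    rw [sum_comm' (t' := univ) (s' := fun x => G.neighborFinset x \ I)
      (by simp [adj_comm, and_comm])]
    refine sum_congr rfl fun x _ => ?_
    rw [sum_const, nsmul_eq_mul]
  have h3 : ∀ x ∈ I, (#(G.neighborFinset x \ I) : ℝ) * f x = B * d := by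
    intro x hx
    have : G.neighborFinset x \ I = G.neighborFinset x := by
      refine sdiff_eq_self_of_disjoint (Finset.disjoint_left.2 fun y hy hyI => ?_)
      exact hI x hx y hyI (by simpa using hy)
    rw [this, card_neighborFinset_eq_degree, hd x]
    simp [f, hx, mul_comm]
  have h4 : ∀ x ∉ I, (#(G.neighborFinset x \ I) : ℝ) * f x =
      -(if #(G.neighborFinset x ∩ I) = 1 then (C : ℝ) * (d - 1 : ℕ) else 0) := by
    intro x hx
    by_cases h : #(G.neighborFinset x ∩ I) = 1
    · have h5 : #(G.neighborFinset x \ I) = d - 1 := by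
        have := card_sdiff_add_card_inter (G.neighborFinset x) I
        rw [h, card_neighborFinset_eq_degree, hd x] at this
        omega
      simp only [f, hx, h, h5, if_true, if_false]
      ring
    · simp [f, hx, h]
  rw [← sum_filter_add_sum_filter_not univ (· ∈ I),
    sum_congr rfl (fun v hv => h1 v (mem_filter.1 hv).2), sum_add_distrib, h2,
    ← sum_filter_add_sum_filter_not univ (· ∈ I) (fun x => (#(G.neighborFinset x \ I) : ℝ) * f x),
    sum_congr rfl (fun x hx => h3 x (mem_filter.1 hx).2),
    sum_congr rfl (fun x hx => h4 x (mem_filter.1 hx).2),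
    sum_congr rfl (fun v hv => h0 v (mem_filter.1 hv).2), sum_neg_distrib, sum_const, sum_const,
    filter_mem_eq_inter, univ_inter, nsmul_eq_mul, nsmul_eq_mul]
  push_cast
  ring

/-- With `M` the set of children of `x` not forbidden by `J`, the largest sets are `{x}` if `M` is
empty, `{x}` and `M` if `#M = 1`, and `M` alone otherwise. So `s ≠ 0` means that all children are
forbidden. -/
theorem exists_cherryType (hg : 6 ≤ G.egirth) (B C : ℕ) {J : Finset V} {v x : V}
    (hvJ : v ∉ J) (hJ : Disjoint J (G.branch 2 v x)) :
    ∃ t ∈ cherryTypes B C,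
      HasForestType G J (G.branch 2 v x) {x} (G.cherryBranchWeight B C v x) t ∧
      (t.s ≠ 0 → ∀ y ∈ (G.neighborFinset x).erase v, ∃ b ∈ J, G.Adj y b) := by
  have hg' : ∀ k : ℕ, k < 6 → (k : ℕ∞) < G.egirth := fun k hk =>
    lt_of_lt_of_le (by exact_mod_cast hk) hg
  set N := (G.neighborFinset x).erase v with hN
  rw [branch_two] at hJ ⊢
  set M := N.filter (fun y => ∀ b ∈ J, ¬ G.Adj y b) with hM
  have hxN : x ∉ N := by simp [hN]
  have hadj : ∀ y ∈ N, G.Adj x y := fun y hy => by simpa using mem_of_mem_erase hy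
  have hNN : ∀ y ∈ N, ∀ z ∈ N, ¬ G.Adj y z := by
    intro y hy z hz hyz
    have hyb : y ∈ G.branch 1 x y := root_mem_branch _ _ _
    have hzb : z ∈ G.branch 1 x z := root_mem_branch _ _ _
    exact not_adj_branch (hg' _ (by norm_num)) (hadj y hy) (hadj z hz) hyz.ne hyb hzb hyz
  have hfam : G.indepFamily J N = M.powerset := by
    ext K
    rw [mem_indepFamily, mem_powerset]
    constructor
    · exact fun h y hy => mem_filter.2 ⟨h.1 hy, h.2.2 y hy⟩
    · intro h
      exact ⟨h.trans (filter_subset _ _), fun y hy z hz =>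
        hNN y (mem_filter.1 (h hy)).1 z (mem_filter.1 (h hz)).1, fun y hy =>
        (mem_filter.1 (h hy)).2⟩
  have hxJ : ∀ b ∈ J, ¬ G.Adj x b := by
    intro b hb hxb
    have : b ∈ N := mem_erase.2 ⟨fun e => hvJ (e ▸ hb), by simpa using hxb⟩
    exact Finset.disjoint_left.1 hJ hb (mem_insert_of_mem this)
  have hsum : ∀ f : Finset V → ℝ, ∑ K ∈ G.indepFamily J (insert x N), f K =
      ∑ K ∈ M.powerset, f K + f {x} := by
    intro f
    rw [sum_indepFamily_insert (R := N) hxN (fun y hy => iff_of_true (hadj y hy) hy) hxJ, hfam,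
      sdiff_self, bot_eq_empty, indepFamily_empty, sum_singleton, insert_empty_eq]
  have htop : ∀ g : Finset V → ℝ, ∑ K ∈ M.powerset, (if #K = #M then g K else 0) = g M := by
    intro g
    rw [sum_eq_single M]
    · simp
    · intro K hK hne
      exact if_neg fun h => hne (eq_of_subset_of_card_le (mem_powerset.1 hK) h.ge)
    · simp
  have hbig : ∀ (g : Finset V → ℝ) (n : ℕ), #M < n →
      ∑ K ∈ M.powerset, (if #K = n then g K else 0) = 0 := fun g n hn =>
    sum_eq_zero fun K hK => if_neg
      (lt_of_le_of_lt (card_le_card (mem_powerset.1 hK)) hn).ne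
  have hle : ∀ K ∈ G.indepFamily J (insert x N), #K ≤ #M ∨ #K ≤ 1 := by
    intro K hK
    obtain ⟨h1, h2, h3⟩ := mem_indepFamily.1 hK
    by_cases hxK : x ∈ K
    · right
      have : Nonempty V := ⟨x⟩
      rw [card_le_one_iff_subset_singleton]
      refine ⟨x, fun y hy => mem_singleton.2 ?_⟩
      by_contra hne
      exact h2 x hxK y hy (hadj y ((mem_insert.1 (h1 hy)).resolve_left hne))
    · left
      refine card_le_card fun y hy => mem_filter.2 ⟨?_, h3 y hy⟩
      exact (mem_insert.1 (h1 hy)).resolve_left fun e => hxK (e ▸ hy)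
  have hwx : G.cherryBranchWeight B C v x {x} = B + C := by simp [cherryBranchWeight]
  have hwM : G.cherryBranchWeight B C v x M = if #M = 1 then 0 else (C : ℝ) := by
    have h1 : x ∉ M := fun h => hxN (mem_filter.1 h).1
    have h2 : N ∩ M = M := inter_eq_right.2 (filter_subset _ _)
    rw [cherryBranchWeight, if_neg h1, ← hN, h2]
  have hnonneg : ∀ K, 0 ≤ G.cherryBranchWeight B C v x K := by
    intro K
    unfold cherryBranchWeight
    split_ifs <;> positivity
  -- The crude weight bound `0` is harmless, as `cherryOK` does not look at `wb`.
  have hout : IsTop (G.indepFamily J (insert x N \ {x})) (G.cherryBranchWeight B C v x)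
      (#M) 1 0 := by
    rw [← erase_eq, erase_insert hxN, hfam]
    refine ⟨fun K hK => card_le_card (mem_powerset.1 hK), one_pos, htop fun _ => 1, ?_⟩
    rw [htop]
    exact hnonneg M
  have hcongr : ∀ K L : Finset V, K ∩ insert x N = L ∩ insert x N →
      G.cherryBranchWeight B C v x K = G.cherryBranchWeight B C v x L := by
    intro K L hKL
    have e1 : x ∈ K ↔ x ∈ L := by simpa using congrArg (x ∈ ·) hKL
    have e2 : N ∩ K = N ∩ L := by
      rw [inter_comm N K, inter_comm N L, ← inter_eq_right.2 (subset_insert x N), ← inter_assoc,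
        hKL, inter_assoc]
    rw [cherryBranchWeight, cherryBranchWeight, ← hN, e2]
    simp only [e1]
  have main : ∀ t : ForestType, t.cb = 1 → t.wb = 0 →
      IsTop (G.indepFamily J (insert x N)) (G.cherryBranchWeight B C v x) (#M + t.s) t.cf t.wf →
      HasForestType G J (insert x N) {x} (G.cherryBranchWeight B C v x) t := by
    intro t h1 h2 h3
    refine ⟨by simp, hcongr, #M, 1, one_pos, by simpa using h3, ?_⟩
    simpa [h1, h2] using hout
  rcases Nat.lt_trichotomy (#M) 1 with h | h | h
  · have h0 : #M = 0 := by omega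
    refine ⟨⟨1, 1, 1, 0, B + C⟩, by simp [cherryTypes], main _ rfl rfl ⟨?_, by simp, ?_, ?_⟩, ?_⟩
    · intro K hK
      have := hle K hK
      simp only
      omega
    · rw [hsum, hbig _ _ (by simp)]
      simp [h0]
    · rw [hsum, hbig _ _ (by simp)]
      simp [h0, hwx]
    · intro _ y hy
      by_contra! hcon
      have : y ∈ M := mem_filter.2 ⟨hy, hcon⟩
      rw [card_eq_zero.1 h0] at this
      simp at this
  · refine ⟨⟨0, 1, 2, 0, B + C⟩, by simp [cherryTypes],
      main _ rfl rfl ⟨?_, by simp, ?_, ?_⟩, by simp⟩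
    · intro K hK
      have := hle K hK
      simp only
      omega
    · rw [hsum, add_zero, htop]
      simp [h]
      norm_num
    · rw [hsum, add_zero, htop, hwM]
      simp [h, hwx]
  · refine ⟨⟨0, 1, 1, 0, C⟩, by simp [cherryTypes],
      main _ rfl rfl ⟨?_, by simp, ?_, ?_⟩, by simp⟩
    · intro K hK
      have := hle K hK
      simp only
      omega
    · rw [hsum, add_zero, htop]
      simp [h.ne]
    · rw [hsum, add_zero, htop, hwM]
      simp [h.ne, h.ne']

/-- The bound for girth six. -/
theorem mul_card_le_of_cherry_check {d : ℕ} (hd : G.IsRegularOfDegree d) {B C D : ℕ}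
    (hroot : allProducts (cherryOK D C d) d (cherryTypes B C) 1 = true) (hg : 6 ≤ G.egirth) :
    (D : ℝ) * Fintype.card V ≤ (D + B * d : ℕ) * G.indepNum := by
  have hg' : ∀ k : ℕ, k < 6 → (k : ℕ∞) < G.egirth := fun k hk =>
    lt_of_lt_of_le (by exact_mod_cast hk) hg
  refine card_mul_le_of_average univ (φ := fun v => G.cherryWeight B C D d v) (fun v _ => ?_)
    fun I hI => sum_cherryWeight hd B C D (mem_filter.1 hI).2.1
  set N := G.neighborFinset v with hN
  set T := N.biUnion fun x => G.branch 2 v x with hT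
  have hadj : ∀ x ∈ N, G.Adj v x := fun x hx => by simpa [hN] using hx
  have hNT : ∀ x ∈ N, x ∈ T := fun x hx => mem_biUnion.2 ⟨x, hx, root_mem_branch _ _ _⟩
  have hvT : v ∉ T := by
    simp only [hT, mem_biUnion, not_exists, not_and]
    exact fun x hx => notMem_branch (hg' 2 (by norm_num)) (hadj x hx)
  have hTN : ∀ y ∈ T, G.Adj v y ↔ y ∈ N := fun y _ => by simp [hN]
  have hNxT : ∀ x ∈ N, (G.neighborFinset x).erase v ⊆ T := fun x hx y hy =>
    mem_biUnion.2 ⟨x, hx, by rw [branch_two]; exact mem_insert_of_mem hy⟩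
  have hcongrx : ∀ x ∈ N, ∀ K L : Finset V, K ∩ T = L ∩ T →
      G.cherryBranchWeight B C v x K = G.cherryBranchWeight B C v x L := by
    intro x hx K L hKL
    have e1 : x ∈ K ↔ x ∈ L := by simpa [hNT x hx] using congrArg (x ∈ ·) hKL
    have e2 : (G.neighborFinset x).erase v ∩ K = (G.neighborFinset x).erase v ∩ L := by
      rw [inter_comm _ K, inter_comm _ L, ← inter_eq_right.2 (hNxT x hx), ← inter_assoc,
        hKL, inter_assoc]
    rw [cherryBranchWeight, cherryBranchWeight, e2]
    simp only [e1]
  refine mul_card_maxIndepSets_le (S := insert v T) ?_ fun J hJ => ?_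
  · intro K L hKL
    have e1 : v ∈ K ↔ v ∈ L := by simpa using congrArg (v ∈ ·) hKL
    have e2 : K ∩ T = L ∩ T := by
      rw [← inter_eq_right.2 (subset_insert v T), ← inter_assoc, hKL, inter_assoc]
    have e3 : N ∩ K = N ∩ L := by
      have hsub : N ⊆ T := hNT
      rw [inter_comm N K, inter_comm N L, ← inter_eq_right.2 hsub, ← inter_assoc, e2, inter_assoc]
    rw [cherryWeight, cherryWeight, ← hN, e3, sum_congr rfl fun x hx => hcongrx x hx K L e2]
    simp only [e1]
  obtain ⟨hvJ, hJb, hJv⟩ := disjoint_root (G := G) (C := N) (fun x hx => by simpa [hN] using hx)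
    (fun x _ => root_mem_branch _ v x) hJ
  have hex : ∀ x : V, ∃ t : ForestType, x ∈ N → t ∈ cherryTypes B C ∧
      HasForestType G J (G.branch 2 v x) {x} (G.cherryBranchWeight B C v x) t ∧
      (t.s ≠ 0 → ∀ y ∈ (G.neighborFinset x).erase v, ∃ b ∈ J, G.Adj y b) := by
    intro x
    by_cases hx : x ∈ N
    · obtain ⟨t, ht⟩ := exists_cherryType hg B C hvJ (hJb x hx)
      exact ⟨t, fun _ => ht⟩
    · exact ⟨1, fun h => absurd h hx⟩
  choose τ hτ using hex
  have hprod := HasForestType.prod N (J := J) (fun x hx => (hτ x hx).2.1)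
    (fun x hx y hy hxy => disjoint_branch (hg' (2 + 2) (by norm_num)) (hadj x hx) (hadj y hy) hxy)
    (fun x hx y hy hxy _ ha _ hb =>
      not_adj_branch (hg' (2 + 2 + 1) (by norm_num)) (hadj x hx) (hadj y hy) hxy ha hb)
  rw [← hT, biUnion_singleton_eq_self] at hprod
  have hok : cherryOK D C d (∏ x ∈ N, τ x) = true := by
    have := of_allProducts hroot (m := N.val.map τ)
      (by rw [Multiset.card_map, card_val, hN, card_neighborFinset_eq_degree, hd v])
      (fun s hs => by
        obtain ⟨x, hx, rfl⟩ := Multiset.mem_map.1 hs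
        exact (hτ x hx).1)
    rwa [one_mul] at this
  have hs : (∏ x ∈ N, τ x).s ≠ 0 → ∃ x ∈ N, (τ x).s ≠ 0 := by
    intro h
    by_contra! hcon
    refine h (prod_induction τ (fun t => t.s = 0) (fun a b ha hb => ?_) rfl hcon)
    simp [ha, hb]
  obtain ⟨n, ρ, hρ, h1, h2⟩ := hprod.isTop
  have hins : ∀ K ∈ G.indepFamily J (T \ N), #(insert v K) = #K + 1 := fun K hK =>
    card_insert_of_notMem fun h => hvT (mem_sdiff.1 ((mem_indepFamily.1 hK).1 h)).1
  have hwin : ∀ K, G.cherryWeight B C D d v (insert v K) = D := fun K => by simp [cherryWeight]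
  have hvK : ∀ K ∈ G.indepFamily J T, v ∉ K := fun K hK h => hvT ((mem_indepFamily.1 hK).1 h)
  have hle : ∀ m : ℕ, n + (∏ x ∈ N, τ x).s ≤ m → n + 1 ≤ m →
      ∀ K ∈ G.indepFamily J (insert v T), #K ≤ m := by
    intro m hm hm' K hK
    by_contra! hlt
    -- Applied to the indicator of an oversized `K`, the splitting formula reads `1 = 0`.
    have hcount := sum_indepFamily_insert hvT hTN hJv fun L => if L = K then (1 : ℝ) else 0
    rw [sum_ite_eq' _ K, if_pos hK, sum_eq_zero, sum_eq_zero] at hcount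
    · norm_num at hcount
    · intro L hL
      refine if_neg fun e => ?_
      have := h2.card_le L hL
      rw [← e, hins L hL] at hlt
      omega
    · intro L hL
      refine if_neg fun e => ?_
      have := h1.card_le L hL
      rw [← e] at hlt
      omega
  have hfree : ∀ m : ℕ, m = n + (∏ x ∈ N, τ x).s →
      ρ * (∏ x ∈ N, τ x).wf - d * C * (ρ * (∏ x ∈ N, τ x).cf) +
        ∑ K ∈ G.indepFamily J T,
          (if #K = m then (if #(N ∩ K) = 1 then (C : ℝ) * (d - 1 : ℕ) else 0) else 0) ≤
      ∑ K ∈ G.indepFamily J T, (if #K = m then G.cherryWeight B C D d v K else 0) := by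
    rintro m rfl
    rw [← h1.count, mul_sum]
    refine (add_le_add_left (sub_le_sub_right h1.weight _) _).trans_eq ?_
    rw [← sum_sub_distrib, ← sum_add_distrib]
    refine sum_congr rfl fun K hK => ?_
    rw [cherryWeight, if_neg (hvK K hK), ← hN]
    by_cases h : #K = n + (∏ x ∈ N, τ x).s <;> simp [h]
  generalize (∏ x ∈ N, τ x) = t at *
  obtain ⟨s, cb, cf, wb, wf⟩ := t
  rcases s with _ | _ | s <;> simp only [zero_add, add_zero] at h1 h2 hle hfree hs
  -- For `s = 0` every largest set contains `v`, and its weight is exactly `D`.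
  · have h0 : ∀ K ∈ G.indepFamily J T, #K ≠ n + 1 := fun K hK => by
      have := h1.card_le K hK
      omega
    refine ⟨n + 1, ρ * cb, D * (ρ * cb), ⟨hle _ (by simp) le_rfl, h2.pos, ?_, ?_⟩, le_rfl⟩
    · rw [sum_indepFamily_insert hvT hTN hJv, sum_eq_zero fun K hK => if_neg (h0 K hK), zero_add,
        ← h2.count]
      refine sum_congr rfl fun K hK => ?_
      simp [hins K hK]
    · rw [sum_indepFamily_insert hvT hTN hJv, sum_eq_zero fun K hK => if_neg (h0 K hK), zero_add,
        ← h2.count, mul_sum]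
      refine (sum_congr rfl fun K hK => ?_).le
      simp [hins K hK, hwin]
  · simp only [cherryOK, Nat.ble_eq] at hok
    obtain ⟨x, hx, hxs⟩ := hs (by simp)
    have hblocked := (hτ x hx).2.2 hxs
    -- As `s = 1`, some neighbour `x` of `v` has all its other neighbours forbidden. Adding `x` to
    -- the largest sets that avoid `N` gives, injectively, largest sets without `v` in which `x` is
    -- the only chosen neighbour of `v`; each of them earns the bonus `C * (d - 1)`.
    have hfew : C * (d - 1 : ℕ) * (ρ * cb) ≤ ∑ K ∈ G.indepFamily J T,
          (if #K = n + 1 then (if #(N ∩ K) = 1 then (C : ℝ) * (d - 1 : ℕ) else 0) else 0) := by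
      rw [← h2.count, mul_sum]
      simp only [← ite_and, mul_ite, mul_one, mul_zero]
      rw [← sum_filter, ← sum_filter, sum_const, sum_const]
      refine nsmul_le_nsmul_left (by positivity) (card_le_card_of_injOn (fun K => insert x K) ?_ ?_)
      · intro K hK
        obtain ⟨hK, hKn⟩ := mem_filter.1 (mem_coe.1 hK)
        obtain ⟨hKT, hK1, hK2⟩ := mem_indepFamily.1 hK
        have hxK : x ∉ K := fun h => (mem_sdiff.1 (hKT h)).2 hx
        have hxadj : ∀ y ∈ K, ¬ G.Adj x y := by
          intro y hy hxy
          obtain ⟨b, hb, hyb⟩ := hblocked y (mem_erase.2 ⟨fun e => hvT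
            (e ▸ (mem_sdiff.1 (hKT hy)).1), by simpa using hxy⟩)
          exact hK2 y hy b hb hyb
        refine mem_coe.2 (mem_filter.2 ⟨mem_indepFamily.2 ⟨?_, ?_, ?_⟩, ?_, ?_⟩)
        · exact insert_subset (hNT x hx) (hKT.trans sdiff_subset)
        · intro y hy z hz hyz
          rcases mem_insert.1 hy with hy | hy <;> rcases mem_insert.1 hz with hz | hz
          · exact hyz.ne (hy.trans hz.symm)
          · exact hxadj z hz (hy ▸ hyz)
          · exact hxadj y hy (hz ▸ hyz.symm)
          · exact hK1 y hy z hz hyz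
        · intro y hy b hb hyb
          rcases mem_insert.1 hy with hy | hy
          · rw [hy] at hyb
            refine Finset.disjoint_left.1 hJ hb (mem_insert_of_mem (hNxT x hx ?_))
            refine mem_erase.2 ⟨fun e => hvJ (e ▸ hb), by simpa using hyb⟩
          · exact hK2 y hy b hb hyb
        · rw [card_insert_of_notMem hxK, hKn]
        · have : N ∩ insert x K = {x} := by
            ext y
            simp only [mem_inter, mem_insert, mem_singleton]
            constructor
            · rintro ⟨hyN, rfl | hyK⟩
              · rfl
              · exact absurd hyN (mem_sdiff.1 (hKT hyK)).2
            · rintro rfl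
              exact ⟨hx, Or.inl rfl⟩
          rw [this, card_singleton]
      · intro K hK L hL hKL
        have h3 : ∀ K ∈ (G.indepFamily J (T \ N)).filter (fun K => #K = n), x ∉ K :=
          fun K hK h => (mem_sdiff.1 ((mem_indepFamily.1 (mem_filter.1 hK).1).1 h)).2 hx
        have := congrArg (fun K => K.erase x) hKL
        simpa [erase_insert (h3 K (mem_coe.1 hK)), erase_insert (h3 L (mem_coe.1 hL))] using this
    refine ⟨n + 1, ρ * cf + ρ * cb, ρ * wf - d * C * (ρ * cf) + C * (d - 1 : ℕ) * (ρ * cb) +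
      D * (ρ * cb), ⟨hle _ le_rfl le_rfl, add_pos h1.pos h2.pos, ?_, ?_⟩, ?_⟩
    · rw [sum_indepFamily_insert hvT hTN hJv, h1.count, ← h2.count]
      congr 1
      refine sum_congr rfl fun K hK => ?_
      simp [hins K hK]
    · rw [sum_indepFamily_insert hvT hTN hJv]
      refine add_le_add ((add_le_add_right hfew _).trans (hfree _ rfl)) ?_
      rw [← h2.count, mul_sum]
      refine (sum_congr rfl fun K hK => ?_).le
      simp [hins K hK, hwin]
    · have : ((D + d * C) * cf : ℝ) ≤ wf + C * (d - 1 : ℕ) * cb := by exact_mod_cast hok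
      nlinarith
  · simp only [cherryOK, Nat.ble_eq] at hok
    have h0 : ∀ K ∈ G.indepFamily J (T \ N), #(insert v K) ≠ n + (s + 1 + 1) := fun K hK => by
      have := h2.card_le K hK
      rw [hins K hK]
      omega
    refine ⟨n + (s + 1 + 1), ρ * cf, ρ * wf - d * C * (ρ * cf),
      ⟨hle _ le_rfl (by omega), h1.pos, ?_, ?_⟩, ?_⟩
    · rw [sum_indepFamily_insert hvT hTN hJv, h1.count, add_eq_left]
      exact sum_eq_zero fun K hK => if_neg (h0 K hK)
    · rw [sum_indepFamily_insert hvT hTN hJv,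
        sum_eq_zero (s := G.indepFamily J (T \ N)) fun K hK => if_neg (h0 K hK), add_zero]
      refine le_trans (le_add_of_nonneg_right ?_) (hfree _ rfl)
      refine sum_nonneg fun K _ => ?_
      split_ifs <;> positivity
    · have : ((D + d * C) * cf : ℝ) ≤ wf := by exact_mod_cast hok
      nlinarith

end SimpleGraph

/-! ### Involutions without short relations -/

/-- The words of length at most `g` without equal neighbouring letters. -/
abbrev ReducedWord (E : Type*) (g : ℕ) : Type _ :=
  {l : List E // l.IsChain (· ≠ ·) ∧ l.length ≤ g}

namespace ReducedWord

variable {E : Type*} {g : ℕ}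

instance [Finite E] : Finite (ReducedWord E g) :=
  Set.Finite.subset (List.finite_length_le E g) fun _ h => h.2

/-- The empty word. -/
def nil : ReducedWord E g := ⟨[], by simp, by simp⟩

open Classical in
/-- Cancel or prepend the letter `e`; leave the word unchanged if it would become too long. -/
noncomputable def toggle (e : E) : ReducedWord E g → ReducedWord E g
  | ⟨[], h⟩ => if hg : 0 < g then ⟨[e], by simp, hg⟩ else ⟨[], h⟩
  | ⟨f :: l, h⟩ =>
    if hef : e = f then ⟨l, h.1.tail, (Nat.le_succ _).trans h.2⟩
    else if hg : (f :: l).length < g then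
      ⟨e :: f :: l, List.isChain_cons_cons.2 ⟨hef, h.1⟩, hg⟩
    else ⟨f :: l, h⟩

theorem toggle_eq_cons {e : E} {l : List E} (h : (e :: l).IsChain (· ≠ ·) ∧ (e :: l).length ≤ g) :
    toggle e ⟨l, h.1.tail, (Nat.le_succ _).trans h.2⟩ = ⟨e :: l, h⟩ := by
  have hlen : l.length < g := h.2
  rcases l with _ | ⟨f, l⟩
  · simp only [toggle]
    rw [dif_pos (by simpa using hlen)]
  · simp only [toggle]
    rw [dif_neg (List.isChain_cons_cons.1 h.1).1, dif_pos hlen]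

theorem toggle_cons {e : E} {l : List E} (h : (e :: l).IsChain (· ≠ ·) ∧ (e :: l).length ≤ g) :
    toggle e ⟨e :: l, h⟩ = ⟨l, h.1.tail, (Nat.le_succ _).trans h.2⟩ := by
  simp [toggle]

theorem toggle_involutive (e : E) : Function.Involutive (toggle (g := g) e) := by
  rintro ⟨l, h⟩
  by_cases h1 : ∃ l', l = e :: l'
  · obtain ⟨l', rfl⟩ := h1
    rw [toggle_cons, toggle_eq_cons]
  · by_cases h2 : l.length < g
    · have h3 : (e :: l).IsChain (· ≠ ·) := by
        rcases l with _ | ⟨f, l⟩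
        · simp
        · exact List.isChain_cons_cons.2 ⟨fun hef => h1 ⟨l, by rw [hef]⟩, h.1⟩
      rw [toggle_eq_cons (l := l) ⟨h3, h2⟩, toggle_cons]
    · have h3 : toggle e ⟨l, h⟩ = ⟨l, h⟩ := by
        rcases l with _ | ⟨f, l⟩
        · simp only [toggle]
          rw [dif_neg (by simpa using h2)]
        · simp only [toggle]
          rw [dif_neg fun hef => h1 ⟨l, by rw [hef]⟩, dif_neg h2]
      rw [h3, h3]

/-- The involution `toggle e` as a permutation. -/
noncomputable def perm (e : E) : Equiv.Perm (ReducedWord E g) :=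
  (toggle_involutive e).toPerm

theorem perm_mul_self (e : E) : perm (g := g) e * perm e = 1 :=
  Equiv.ext (toggle_involutive e)

/-- Acting on the empty word, the letters are prepended one after the other; no two cancel, and the
length cutoff is never hit. Hence a nonempty reduced product moves the empty word. -/
theorem prod_perm_apply_nil (l : List E) (h : l.IsChain (· ≠ ·) ∧ l.length ≤ g) :
    (l.map perm).prod (nil : ReducedWord E g) = ⟨l, h⟩ := by
  induction l with
  | nil => rfl
  | cons e l ih =>
    rw [List.map_cons, List.prod_cons, Equiv.Perm.mul_apply,
      ih ⟨h.1.tail, (Nat.le_succ _).trans h.2⟩]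
    exact toggle_eq_cons h

theorem prod_perm_ne_one {l : List E} (h : l.IsChain (· ≠ ·)) (hg : l.length ≤ g) (hl : l ≠ []) :
    (l.map (perm (g := g))).prod ≠ 1 := by
  intro h1
  have h2 := prod_perm_apply_nil l ⟨h, hg⟩
  rw [h1] at h2
  exact hl (congrArg Subtype.val h2).symm

end ReducedWord

/-! ### Joining copies of a graph without creating short cycles -/

namespace SimpleGraph

/-- Copies of `G` indexed by the group `Γ`, in which each `e` joins the copies of the vertex `π e`
in pairs by means of the involution `s e`. -/
def joinCopies {V E Γ : Type*} [Group Γ] (G : SimpleGraph V) (π : E → V) (s : E → Γ)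
    (hs : ∀ e, s e * s e = 1) (hs' : ∀ e, s e ≠ 1) : SimpleGraph (V × Γ) where
  Adj a b := (a.2 = b.2 ∧ G.Adj a.1 b.1) ∨ ∃ e, π e = a.1 ∧ a.1 = b.1 ∧ b.2 = a.2 * s e
  symm := ⟨by
    rintro a b (h | ⟨e, h1, h2, h3⟩)
    · exact Or.inl ⟨h.1.symm, h.2.symm⟩
    · exact Or.inr ⟨e, h1.trans h2, h2.symm, by rw [h3, mul_assoc, hs, mul_one]⟩⟩
  loopless := ⟨by
    rintro a (h | ⟨e, -, -, h⟩)
    · exact h.2.ne rfl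
    · exact hs' e (by simpa using h)⟩

section

variable {V E Γ : Type*} [Group Γ] {G : SimpleGraph V} {π : E → V} {s : E → Γ}
  {hs : ∀ e, s e * s e = 1} {hs' : ∀ e, s e ≠ 1}

theorem joinCopies_adj {a b : V × Γ} : (G.joinCopies π s hs hs').Adj a b ↔
    (a.2 = b.2 ∧ G.Adj a.1 b.1) ∨ ∃ e, π e = a.1 ∧ a.1 = b.1 ∧ b.2 = a.2 * s e :=
  Iff.rfl

/-- The word records the joining edges used. It is reduced because within one copy all `e`-edges sit
at the single vertex `π e`: using `e` twice in succession would revisit that vertex. The data on the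
first letter carry the induction and later detect a repeated edge. -/
theorem exists_word_of_isPath {a b : V × Γ} {p : (G.joinCopies π s hs hs').Walk a b}
    (hp : p.IsPath) : ∃ l : List E, l.IsChain (· ≠ ·) ∧ l.length ≤ p.length ∧
      b.2 = a.2 * (l.map s).prod ∧ (l = [] → ∀ c ∈ p.support, c.2 = a.2) ∧
      ∀ e l', l = e :: l' → (π e, a.2) ∈ p.support ∧ (π e, a.2 * s e) ∈ p.support ∧
        (π e = a.1 → s(a, (a.1, a.2 * s e)) ∈ p.edges) := by
  induction p with
  | nil => exact ⟨[], by simp, by simp, by simp, by simp, by simp⟩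
  | @cons a b c h p ih =>
    rw [Walk.cons_isPath_iff] at hp
    obtain ⟨l, h1, h2, h3, h4, h5⟩ := ih hp.1
    rcases joinCopies_adj.1 h with h' | ⟨e, he1, he2, he3⟩
    · refine ⟨l, h1, by rw [Walk.length_cons]; omega, by rw [h3, h'.1], ?_, ?_⟩
      · intro hl x hx
        rcases List.mem_cons.1 (Walk.support_cons _ _ ▸ hx) with rfl | hx
        · rfl
        · rw [h4 hl x hx, h'.1]
      · intro e l' hl
        rw [Walk.support_cons, h'.1]
        refine ⟨List.mem_cons_of_mem _ (h5 e l' hl).1, List.mem_cons_of_mem _ (h5 e l' hl).2.1,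
          fun hea => absurd (h5 e l' hl).1 ?_⟩
        rw [hea, ← h'.1]
        exact hp.2
    · refine ⟨e :: l, ?_, by simpa using h2, ?_, by simp, ?_⟩
      · rcases l with _ | ⟨f, l⟩
        · simp
        · refine List.isChain_cons_cons.2 ⟨?_, h1⟩
          rintro rfl
          refine hp.2 ?_
          have := (h5 e l rfl).2.1
          rw [he3, mul_assoc, hs, mul_one, he1] at this
          exact this
      · rw [h3, he3, List.map_cons, List.prod_cons, mul_assoc]
      · intro f l' hl
        obtain ⟨rfl, -⟩ := List.cons_eq_cons.1 hl
        rw [Walk.support_cons, he1, ← he3]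
        refine ⟨List.mem_cons_self, List.mem_cons_of_mem _ (he2 ▸ p.start_mem_support), fun _ => ?_⟩
        rw [Walk.edges_cons, he2]
        exact List.mem_cons_self

theorem exists_walk_of_support {a b : V × Γ} (p : (G.joinCopies π s hs hs').Walk a b)
    (hp : ∀ c ∈ p.support, c.2 = a.2) :
    ∃ q : G.Walk a.1 b.1, q.support = p.support.map Prod.fst := by
  induction p with
  | nil => exact ⟨.nil, by simp⟩
  | @cons a b c h p ih =>
    have hb : b.2 = a.2 := hp b (by simp)
    obtain ⟨q, hq⟩ := ih fun c hc => (hp c (by simp [hc])).trans hb.symm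
    rcases joinCopies_adj.1 h with h | ⟨e, -, -, he⟩
    · exact ⟨.cons h.2 q, by simp [hq]⟩
    · exact absurd (by simpa [hb] using he) (hs' e)

/-- A short cycle either stays in one copy, contradicting the girth of `G`, or spells a nonempty
reduced word of length at most `g` with trivial product. -/
theorem le_egirth_joinCopies {g : ℕ} (hG : (g : ℕ∞) ≤ G.egirth)
    (hword : ∀ l : List E, l.IsChain (· ≠ ·) → l.length ≤ g → l ≠ [] → (l.map s).prod ≠ 1) :
    (g : ℕ∞) ≤ (G.joinCopies π s hs hs').egirth := by
  rw [le_egirth]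
  intro a c hc
  by_contra! hlt
  have hlt : c.length < g := by exact_mod_cast hlt
  obtain ⟨b, h, p, rfl⟩ : ∃ (b : V × Γ) (h : _) (p : _), c = Walk.cons h p (v := b) := by
    rcases c with _ | ⟨h, p⟩
    · exact absurd rfl hc.ne_nil
    · exact ⟨_, h, p, rfl⟩
  have h3 := hc.three_le_length
  rw [Walk.length_cons] at h3 hlt
  rw [Walk.cons_isCycle_iff] at hc
  obtain ⟨l, h1, h2, hl3, h4, h5⟩ := exists_word_of_isPath hc.1
  rcases joinCopies_adj.1 h with h | ⟨e, he1, he2, he3⟩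
  · have hl : l = [] := by
      by_contra hl
      refine hword l h1 (by omega) hl ?_
      rw [h.1] at hl3
      simpa using hl3.symm
    obtain ⟨q, hq⟩ := exists_walk_of_support p (h4 hl)
    have hqp : q.IsPath := by
      rw [Walk.isPath_def, hq]
      refine List.Nodup.map_on ?_ hc.1.support_nodup
      intro x hx y hy hxy
      exact Prod.ext hxy ((h4 hl x hx).trans (h4 hl y hy).symm)
    have hlen : q.length = p.length := by
      have := congrArg List.length hq
      simpa using this
    have hedge : (Walk.cons h.2.symm Walk.nil).IsPath := by
      simp [Walk.cons_isPath_iff, h.2.ne']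
    have := hqp.eq_of_length_add_length_lt_egirth hedge
      (lt_of_lt_of_le (by simp only [Walk.length_cons, Walk.length_nil]; exact_mod_cast
        (by omega)) hG)
    have := congrArg Walk.length this
    simp only [Walk.length_cons, Walk.length_nil] at this
    omega
  · rcases l with _ | ⟨f, l⟩
    · rw [he3] at hl3
      exact hs' e (by simpa [mul_assoc] using hl3.symm)
    -- If the rest of the cycle begins with the same letter, it reuses the first edge; otherwise
    -- prepending `e` keeps the word reduced.
    by_cases hef : e = f
    · subst hef
      have hb := (h5 e l rfl).2.2 (he1.trans he2)
      refine hc.2 ?_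
      rwa [Sym2.eq_swap, show ((b.1, b.2 * s e) : V × Γ) = a from
        Prod.ext he2.symm (by rw [he3, mul_assoc, hs, mul_one])] at hb
    · refine hword (e :: f :: l) (List.isChain_cons_cons.2 ⟨hef, h1⟩) (by
        simp only [List.length_cons] at h2 ⊢
        omega) (by simp) ?_
      rw [he3, mul_assoc, ← List.prod_cons, ← List.map_cons] at hl3
      simpa using hl3.symm

end

end SimpleGraph

namespace SimpleGraph

/-- An independent set meets each copy of `G` in an independent set. -/
theorem indepNum_joinCopies_le {V E Γ : Type*} [Finite V] [Group Γ] [Fintype Γ]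
    {G : SimpleGraph V} {π : E → V} {s : E → Γ} {hs : ∀ e, s e * s e = 1} {hs' : ∀ e, s e ≠ 1} :
    (G.joinCopies π s hs hs').indepNum ≤ Fintype.card Γ * G.indepNum := by
  classical
  have := Fintype.ofFinite V
  obtain ⟨I, hI⟩ := (G.joinCopies π s hs hs').exists_isNIndepSet_indepNum
  rw [← hI.card_eq, card_eq_sum_card_fiberwise (f := Prod.snd) (t := univ) (by simp),
    ← smul_eq_mul, ← card_univ, ← sum_const]
  refine sum_le_sum fun x _ => ?_
  rw [← card_image_of_injOn (f := Prod.fst) (s := I.filter fun a => a.2 = x)]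
  · refine card_le_indepNum fun v hv w hw hvw => ?_
    obtain ⟨a, ha, rfl⟩ := mem_image.1 hv
    obtain ⟨b, hb, rfl⟩ := mem_image.1 hw
    obtain ⟨haI, ha⟩ := mem_filter.1 ha
    obtain ⟨hbI, hb⟩ := mem_filter.1 hb
    have hadj : (G.joinCopies π s hs hs').Adj a b := Or.inl ⟨ha.trans hb.symm, hvw⟩
    exact hI.isIndepSet (mem_coe.2 haI) (mem_coe.2 hbI) hadj.ne hadj
  · intro a ha b hb hab
    have ha := (mem_filter.1 (mem_coe.1 ha)).2
    have hb := (mem_filter.1 (mem_coe.1 hb)).2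
    exact Prod.ext hab (ha.trans hb.symm)

/-- A bound on the number of vertices in terms of the independence number that holds for all
`d`-regular graphs of girth at least `g` holds for all graphs of maximum degree at most `d` and
girth at least `g`. -/
theorem card_le_of_forall_isRegularOfDegree {d g : ℕ} (hg : 2 ≤ g) {b : ℝ} (hb : 0 ≤ b)
    (H : ∀ (W : Type) [Fintype W] [DecidableEq W] (G : SimpleGraph W) [DecidableRel G.Adj],
      G.IsRegularOfDegree d → (g : ℕ∞) ≤ G.egirth → (Fintype.card W : ℝ) ≤ b * G.indepNum)
    {V : Type} [Fintype V] (G : SimpleGraph V) [DecidableRel G.Adj] (hd : ∀ v, G.degree v ≤ d)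
    (hG : (g : ℕ∞) ≤ G.egirth) : (Fintype.card V : ℝ) ≤ b * G.indepNum := by
  classical
  -- One letter for each missing edge at each vertex, so that joining makes the graph `d`-regular.
  let E := Σ v : V, Fin (d - G.degree v)
  let Γ := Equiv.Perm (ReducedWord E g)
  have : Fintype (ReducedWord E g) := Fintype.ofFinite _
  let s : E → Γ := ReducedWord.perm
  have hword : ∀ l : List E, l.IsChain (· ≠ ·) → l.length ≤ g → l ≠ [] → (l.map s).prod ≠ 1 :=
    fun l => ReducedWord.prod_perm_ne_one
  have hs : ∀ e, s e * s e = 1 := ReducedWord.perm_mul_self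
  have hs' : ∀ e, s e ≠ 1 := fun e => by
    simpa using hword [e] (by simp) (by simp; omega) (by simp)
  -- Different letters at one vertex must lead to different copies; this uses words of length two,
  -- hence `2 ≤ g`.
  have hinj : Function.Injective s := by
    intro e f hef
    by_contra hne
    refine hword [e, f] (by simp [hne]) (by simpa using hg) (by simp) ?_
    simp [← hef, hs]
  let G' := G.joinCopies Sigma.fst s hs hs'
  have hreg : G'.IsRegularOfDegree d := by
    rintro ⟨v, x⟩
    have hN : G'.neighborFinset (v, x) = (G.neighborFinset v).image (fun w => (w, x)) ∪
        (univ : Finset (Fin (d - G.degree v))).image (fun i => (v, x * s ⟨v, i⟩)) := by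
      ext ⟨w, y⟩
      simp only [mem_neighborFinset, mem_union, mem_image, mem_univ, true_and, Prod.mk.injEq]
      constructor
      · rintro (⟨h1, h2⟩ | ⟨⟨u, i⟩, h1, h2, h3⟩)
        · exact Or.inl ⟨w, h2, rfl, h1⟩
        · obtain rfl : u = v := h1
          exact Or.inr ⟨i, h2, h3.symm⟩
      · rintro (⟨u, h1, rfl, rfl⟩ | ⟨i, rfl, rfl⟩)
        · exact Or.inl ⟨rfl, h1⟩
        · exact Or.inr ⟨⟨v, i⟩, rfl, rfl, rfl⟩
    rw [← card_neighborFinset_eq_degree, hN, card_union_of_disjoint, card_image_of_injective,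
      card_image_of_injective, card_neighborFinset_eq_degree, card_univ, Fintype.card_fin]
    · have := hd v
      omega
    · intro i j hij
      exact eq_of_heq (Sigma.mk.inj_iff.1 (hinj (mul_left_cancel (Prod.mk.inj hij).2))).2
    · exact fun i j hij => (Prod.mk.inj hij).1
    · rw [Finset.disjoint_left]
      intro a ha ha'
      obtain ⟨w, hw, rfl⟩ := mem_image.1 ha
      obtain ⟨i, -, hi⟩ := mem_image.1 ha'
      have : G.Adj v w := by simpa using hw
      exact this.ne (Prod.mk.inj hi).1
  have h1 := H (V × Γ) G' hreg (le_egirth_joinCopies hG hword)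
  have h2 : (G'.indepNum : ℝ) ≤ Fintype.card Γ * G.indepNum := by
    exact_mod_cast indepNum_joinCopies_le
  rw [Fintype.card_prod, Nat.cast_mul] at h1
  have h3 : (0 : ℝ) < Fintype.card Γ := by exact_mod_cast Fintype.card_pos
  refine le_of_mul_le_mul_left ?_ h3
  nlinarith [mul_le_mul_of_nonneg_left h2 hb]

end SimpleGraph

open SimpleGraph

/-- Degrees do not grow in a subgraph and its cycles are cycles of the whole graph, so the bound for
regular graphs applies to every subgraph. -/
theorem hallRatioSup_le {d g : ℕ} (hg : 2 ≤ g) {b : ℝ} (hb : 0 ≤ b)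
    (H : ∀ (W : Type) [Fintype W] [DecidableEq W] (G : SimpleGraph W) [DecidableRel G.Adj],
      G.IsRegularOfDegree d → (g : ℕ∞) ≤ G.egirth → (Fintype.card W : ℝ) ≤ b * G.indepNum) :
    hallRatioSup d g ≤ (b : EReal) := by
  classical
  refine iSup_le fun n => iSup_le fun G => iSup_le fun hd => iSup_le fun hG => ?_
  rw [EReal.coe_le_coe_iff]
  refine ciSup_le fun K => ?_
  refine div_le_of_le_mul₀ (Nat.cast_nonneg _) hb ?_
  rw [Nat.card_eq_fintype_card]
  refine card_le_of_forall_isRegularOfDegree hg hb H K.coe (fun v => ?_) ?_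
  · rw [Subgraph.coe_degree]
    refine (K.degree_le v).trans (le_trans ?_ hd)
    convert G.degree_le_maxDegree (v : Fin n)
  · rw [le_egirth]
    intro a w hw
    have := egirth_le_length (hw.map (f := K.hom) Subgraph.hom_injective)
    rw [Walk.length_map] at this
    exact hG.trans this

/-! ### Checks of the inequality at the root -/

namespace ForestType

/-- A test for the local inequality at a vertex of degree `d` whose branches have data in
`L₁ ++ L₀`, where `L₁` holds the data with `s = 1` and `L₀` those with `s = 0`. If the root is
always or never chosen, linear bounds with coefficients `x`, `y`, `E` and `x'`, `E'` suffice. -/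
def vertexCheck (D a d x y E x' E' : ℕ) (L₁ L₀ : List ForestType) : Bool :=
  L₁.all (fun t => Nat.beq t.s 1 && Nat.ble (t.cf * (x + y)) (E * t.wf)) &&
  L₀.all (fun t => Nat.beq t.s 0 && Nat.ble (t.cf * x) (E * t.wf) &&
    Nat.ble (t.cb * x') (E' * t.wb)) &&
  Nat.blt 0 E && Nat.ble (D * E) (d * x + 2 * y) &&
  Nat.blt 0 E' && Nat.ble (D * E') (d * x' + a * E') &&
  L₁.all (fun t => allProducts (rootOK D a) (d - 1) L₀ t)

/-- The average weight `wf / cf` is additive under products, as is `s`; a linear lower bound for the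
factors therefore passes to the product. -/
theorem prod_wf_bound {x y E : ℕ} {m : Multiset ForestType}
    (h : ∀ t ∈ m, t.cf * (x + y * t.s) ≤ E * t.wf) :
    m.prod.cf * (m.card * x + y * m.prod.s) ≤ E * m.prod.wf := by
  induction m using Multiset.induction_on with
  | empty => simp
  | cons t m ih =>
    have h1 := ih fun u hu => h u (Multiset.mem_cons_of_mem hu)
    have h2 := h t (Multiset.mem_cons_self t m)
    simp only [Multiset.prod_cons, Multiset.card_cons, mul_cf, mul_s, mul_wf]
    nlinarith [Nat.mul_le_mul_left t.cf h1, Nat.mul_le_mul_right m.prod.cf h2]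

theorem prod_wb_bound {x E : ℕ} {m : Multiset ForestType}
    (h : ∀ t ∈ m, t.cb * x ≤ E * t.wb) :
    m.prod.cb * (m.card * x) ≤ E * m.prod.wb := by
  induction m using Multiset.induction_on with
  | empty => simp
  | cons t m ih =>
    have h1 := ih fun u hu => h u (Multiset.mem_cons_of_mem hu)
    have h2 := h t (Multiset.mem_cons_self t m)
    simp only [Multiset.prod_cons, Multiset.card_cons, mul_cb, mul_wb]
    nlinarith [Nat.mul_le_mul_left t.cb h1, Nat.mul_le_mul_right m.prod.cb h2]

theorem rootOK_of_vertexCheck {D a d x y E x' E' : ℕ} {L₁ L₀ : List ForestType}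
    (h : vertexCheck D a d x y E x' E' L₁ L₀ = true) (m : Multiset ForestType) (hm : m.card = d)
    (hL : ∀ t ∈ m, t ∈ L₁ ++ L₀) : rootOK D a m.prod = true := by
  simp only [vertexCheck, Bool.and_eq_true, List.all_eq_true, Nat.beq_eq, Nat.blt_eq,
    Nat.ble_eq] at h
  obtain ⟨⟨⟨⟨⟨⟨hL₁, hL₀⟩, hE⟩, hDE⟩, hE'⟩, hDE'⟩, hone⟩ := h
  have hwf : ∀ t ∈ m, t.cf * (x + y * t.s) ≤ E * t.wf := by
    intro t ht
    rcases List.mem_append.1 (hL t ht) with h | h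
    · simpa [(hL₁ t h).1] using (hL₁ t h).2
    · simpa [(hL₀ t h).1.1] using (hL₀ t h).1.2
  have hall := prod_wf_bound hwf
  -- Two factors from `L₁` force `s ≥ 2`, so the root is never chosen; no such factor gives `s = 0`,
  -- and the root is always chosen. The linear bounds settle both cases, and only the case of
  -- exactly one factor needs enumeration.
  by_cases h1 : ∃ t ∈ m, t ∈ L₁
  · obtain ⟨t, htm, ht⟩ := h1
    obtain ⟨m, rfl⟩ := Multiset.exists_cons_of_mem htm
    by_cases h2 : ∃ u ∈ m, u ∈ L₁
    · obtain ⟨u, hum, hu⟩ := h2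
      obtain ⟨m, rfl⟩ := Multiset.exists_cons_of_mem hum
      have hs : 2 ≤ (t ::ₘ u ::ₘ m).prod.s := by
        simp only [Multiset.prod_cons, mul_s, (hL₁ t ht).1, (hL₁ u hu).1]
        omega
      rw [hm] at hall
      revert hs hall
      generalize (t ::ₘ u ::ₘ m).prod = p
      obtain ⟨s, cb, cf, wb, wf⟩ := p
      intro hall hs
      rcases s with _ | _ | s
      · simp at hs
      · simp at hs
      · simp only [rootOK, Nat.ble_eq] at hall ⊢
        have h3 : D * E ≤ d * x + y * (s + 1 + 1) := hDE.trans (by have := Nat.mul_le_mul_left y (show 2 ≤ s + 1 + 1 by omega); omega)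
        have h4 := Nat.mul_le_mul_left cf h3
        refine Nat.le_of_mul_le_mul_left ?_ hE
        calc E * (D * cf) = cf * (D * E) := by ring
          _ ≤ _ := h4.trans hall
    · push Not at h2
      rw [Multiset.prod_cons]
      refine of_allProducts (hone t ht) (by simp at hm; omega) fun u hu => ?_
      exact (List.mem_append.1 (hL u (Multiset.mem_cons_of_mem hu))).resolve_left (h2 u hu)
  · push Not at h1
    have hm₀ : ∀ t ∈ m, t ∈ L₀ := fun t ht =>
      (List.mem_append.1 (hL t ht)).resolve_left (h1 t ht)
    have hs : m.prod.s = 0 := by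
      refine Multiset.prod_induction (fun t => t.s = 0) m (fun a b ha hb => ?_) rfl
        fun t ht => (hL₀ t (hm₀ t ht)).1.1
      simp [ha, hb]
    have hwb := prod_wb_bound fun t ht => (hL₀ t (hm₀ t ht)).2
    rw [hm] at hwb
    revert hs hwb
    generalize m.prod = p
    obtain ⟨s, cb, cf, wb, wf⟩ := p
    rintro rfl hwb
    simp only [rootOK, Nat.ble_eq] at hwb ⊢
    refine Nat.le_of_mul_le_mul_left ?_ hE'
    have h4 := Nat.mul_le_mul_left cb hDE'
    calc E' * (D * cb) = cb * (D * E') := by ring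
      _ ≤ cb * (d * x' + a * E') := h4
      _ ≤ E' * (wb + a * cb) := by nlinarith
      _ = _ := rfl

/-- A test for the local inequality at an edge. -/
def edgeCheck (D a n : ℕ) (L L' : List ForestType) : Bool :=
  L'.all fun t => allProducts (rootOK D a) n L t

theorem rootOK_of_edgeCheck {D a n : ℕ} {L L' : List ForestType}
    (h : edgeCheck D a n L L' = true) (m : Multiset ForestType) (hm : m.card = n)
    (hL : ∀ t ∈ m, t ∈ L) (t : ForestType) (ht : t ∈ L') : rootOK D a (t * m.prod) = true :=
  of_allProducts (List.all_eq_true.1 h t ht) hm hL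

end ForestType

/-! ### Numerical certificates -/

namespace ForestType

/-- Branch data with `s = 1` for degree 3 and girth 8. -/
def inTypes_d3_g8 : List ForestType :=
  [⟨1, 1, 1, 336, 984⟩, ⟨1, 2, 1, 744, 900⟩, ⟨1, 4, 1, 1632, 816⟩]

/-- Branch data with `s = 0` for degree 3 and girth 8. -/
def outTypes_d3_g8 : List ForestType :=
  [⟨0, 1, 2, 492, 1308⟩, ⟨0, 2, 3, 1056, 1788⟩, ⟨0, 1, 1, 648, 648⟩]

/-- Weights are listed from the neighbours of the centre outwards; the centre's own weight appears
in the root check. -/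
theorem isComplete_d3_g8 : IsComplete 3
    [648, 324, 84]
    (inTypes_d3_g8 ++ outTypes_d3_g8) :=
  .cons _ _ (by decide +kernel) (.cons _
    [⟨1, 1, 1, 0, 324⟩, ⟨0, 1, 1, 168, 168⟩, ⟨0, 1, 2, 84, 408⟩]
    (by decide +kernel) (.leaf _))

/-- Here 596 is the least `wf / cf` among the data with `s = 0`, 596 + 220 = 816 the least among
those with `s = 1`, and 492 the least `wb / cb` for `s = 0`. The bound with two data of the second
kind is tight: 3·596 + 2·220 = 2228. -/
theorem vertexCheck_d3_g8 : vertexCheck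
    2228 953 3 596 220 1 492 1
    inTypes_d3_g8 outTypes_d3_g8 = true := by
  decide +kernel

/-- Branch data below an end of an edge for degree 3 and girth 9. -/
def lowerTypes_d3_g9 : List ForestType :=
  [⟨1, 1, 1, 8, 28⟩, ⟨1, 2, 1, 19, 26⟩, ⟨1, 4, 1, 44, 24⟩, ⟨0, 1, 2, 13, 37⟩, ⟨0, 2, 3, 29, 51⟩,
   ⟨0, 1, 1, 18, 18⟩]

/-- Branch data at an end of an edge for degree 3 and girth 9. -/
def upperTypes_d3_g9 : List ForestType :=
  [⟨1, 4, 1, 148, 59⟩, ⟨1, 6, 2, 213, 121⟩, ⟨1, 2, 1, 73, 64⟩, ⟨1, 9, 4, 306, 248⟩,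
   ⟨1, 3, 2, 105, 131⟩, ⟨1, 1, 1, 36, 69⟩, ⟨0, 2, 3, 93, 147⟩, ⟨0, 3, 5, 135, 246⟩,
   ⟨0, 2, 4, 89, 200⟩, ⟨0, 3, 7, 129, 357⟩, ⟨0, 2, 6, 85, 313⟩, ⟨0, 1, 1, 48, 48⟩,
   ⟨0, 3, 11, 123, 591⟩, ⟨0, 1, 5, 42, 290⟩]

theorem isComplete_d3_g9 : IsComplete 3
    [20, 9, 2]
    lowerTypes_d3_g9 :=
  .cons _ _ (by decide +kernel) (.cons _
    [⟨1, 1, 1, 0, 9⟩, ⟨0, 1, 1, 4, 4⟩, ⟨0, 1, 2, 2, 11⟩]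
    (by decide +kernel) (.leaf _))

theorem isComplete_cons_d3_g9 : IsComplete 3
    [33, 20, 9, 2]
    upperTypes_d3_g9 :=
  .cons _ _ (by decide +kernel) isComplete_d3_g9

theorem edgeCheck_d3_g9 : edgeCheck 96 33 2
    lowerTypes_d3_g9 upperTypes_d3_g9 = true := by
  decide +kernel

/-- Branch data with `s = 1` for degree 3 and girth 10. -/
def inTypes_d3_g10 : List ForestType :=
  [⟨1, 4, 1, 732357792, 300389733⟩, ⟨1, 3, 1, 527604012, 307305243⟩,
   ⟨1, 2, 1, 365068584, 324775341⟩, ⟨1, 9, 4, 1517819040, 1256883012⟩,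
   ⟨1, 3, 2, 525938544, 663381702⟩, ⟨1, 1, 1, 181979136, 349160949⟩]

/-- Branch data with `s = 0` for degree 3 and girth 10. -/
def outTypes_d3_g10 : List ForestType :=
  [⟨0, 2, 3, 458278776, 734282901⟩, ⟨0, 3, 5, 665753832, 1231593102⟩,
   ⟨0, 1, 2, 218584800, 501504435⟩, ⟨0, 3, 7, 634090068, 1793430648⟩,
   ⟨0, 1, 3, 208030212, 787700502⟩, ⟨0, 1, 1, 232970976, 232970976⟩,
   ⟨0, 3, 11, 602426304, 2976431544⟩, ⟨0, 1, 5, 207475056, 1464358068⟩]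

theorem isComplete_d3_g10 : IsComplete 3
    [167181813, 95376312, 45494784, 10554588]
    (inTypes_d3_g10 ++ outTypes_d3_g10) :=
  .cons _ _ (by decide +kernel) (.cons _
    [⟨1, 1, 1, 42218352, 137594664⟩, ⟨1, 2, 1, 98267724, 127040076⟩,
     ⟨1, 4, 1, 224197488, 116485488⟩, ⟨0, 1, 2, 66603960, 183089448⟩,
     ⟨0, 2, 3, 147038940, 252969840⟩, ⟨0, 1, 1, 90989568, 90989568⟩]
    (by decide +kernel) (.cons _
    [⟨1, 1, 1, 0, 45494784⟩, ⟨0, 1, 1, 21109176, 21109176⟩, ⟨0, 1, 2, 10554588, 56049372⟩]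
    (by decide +kernel) (.leaf _)))

theorem vertexCheck_d3_g10 : vertexCheck
    820777797 225822361 3 232970976 67418757 1 200808768 1
    inTypes_d3_g10 outTypes_d3_g10 = true := by
  decide +kernel

/-- Branch data below an end of an edge for degree 3 and girth 11. -/
def lowerTypes_d3_g11 : List ForestType :=
  [⟨1, 4, 1, 28203448, 11488430⟩, ⟨1, 3, 1, 20326251, 11760635⟩, ⟨1, 2, 1, 14059330, 12435409⟩,
   ⟨1, 9, 4, 58499748, 48131360⟩, ⟨1, 3, 2, 20262660, 25415228⟩, ⟨1, 1, 1, 7008468, 13382388⟩,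
   ⟨0, 2, 3, 17648352, 28189803⟩, ⟨0, 3, 5, 25646193, 47273505⟩, ⟨0, 1, 2, 8421607, 19235263⟩,
   ⟨0, 3, 7, 24438486, 68781930⟩, ⟨0, 1, 3, 8019038, 30190760⟩, ⟨0, 1, 1, 8987214, 8987214⟩,
   ⟨0, 3, 11, 23230779, 114095307⟩, ⟨0, 1, 5, 7997841, 56129201⟩]

/-- Branch data at an end of an edge for degree 3 and girth 11. -/
def upperTypes_d3_g11 : List ForestType :=
  [⟨1, 9, 4, 169138818, 105109472⟩, ⟨1, 5, 2, 94256510, 52003846⟩, ⟨1, 6, 2, 114085395, 51749598⟩,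
   ⟨1, 7, 2, 134558137, 51198708⟩, ⟨1, 9, 2, 175141689, 50944460⟩, ⟨1, 3, 2, 55151445, 52880812⟩,
   ⟨1, 11, 2, 217457918, 50393570⟩, ⟨1, 15, 2, 309336618, 50902066⟩,
   ⟨1, 25, 9, 472735050, 231538302⟩, ⟨1, 10, 3, 190723325, 76798062⟩,
   ⟨1, 35, 9, 674824185, 227915181⟩, ⟨1, 15, 3, 292774315, 75590355⟩,
   ⟨1, 5, 3, 92209575, 78494883⟩, ⟨1, 55, 9, 1090485090, 224292060⟩,
   ⟨1, 25, 3, 517013530, 75526764⟩, ⟨1, 4, 1, 76941052, 25472230⟩,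
   ⟨1, 14, 3, 272210701, 75590355⟩, ⟨1, 6, 1, 118087309, 25069661⟩, ⟨1, 2, 1, 37209691, 26037837⟩,
   ⟨1, 22, 3, 439778507, 74382648⟩, ⟨1, 10, 1, 208434717, 25048464⟩,
   ⟨1, 49, 9, 962947020, 224292060⟩, ⟨1, 21, 3, 417681110, 74382648⟩,
   ⟨1, 7, 3, 131692428, 77287176⟩, ⟨1, 77, 9, 1555268379, 220668939⟩,
   ⟨1, 35, 3, 736814057, 74319057⟩, ⟨1, 9, 1, 181144560, 24667092⟩, ⟨1, 3, 1, 57152402, 25635268⟩,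
   ⟨1, 33, 3, 674384281, 73174941⟩, ⟨1, 15, 1, 319341403, 24645895⟩,
   ⟨1, 1, 1, 17974428, 26603444⟩, ⟨1, 11, 3, 212954661, 76079469⟩,
   ⟨1, 121, 9, 2510096754, 217045818⟩, ⟨1, 55, 3, 1187897746, 73111350⟩,
   ⟨1, 25, 1, 561292010, 24624698⟩, ⟨0, 3, 11, 62655093, 258687525⟩,
   ⟨0, 5, 17, 104715655, 395458963⟩, ⟨0, 5, 14, 106076680, 321655156⟩,
   ⟨0, 5, 11, 109450550, 254695022⟩, ⟨0, 20, 47, 429750820, 1069049233⟩,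
   ⟨0, 10, 19, 221623150, 437010853⟩, ⟨0, 5, 8, 114185445, 186744090⟩,
   ⟨0, 2, 6, 42212123, 138618063⟩, ⟨0, 2, 5, 42756533, 114234653⟩,
   ⟨0, 8, 17, 173203772, 385159127⟩, ⟨0, 7, 19, 149200940, 435113420⟩,
   ⟨0, 7, 16, 151106375, 363061730⟩, ⟨0, 7, 13, 155829793, 298658851⟩,
   ⟨0, 28, 55, 612047240, 1240476290⟩, ⟨0, 14, 23, 315470456, 527235038⟩,
   ⟨0, 7, 10, 162458646, 233809584⟩, ⟨0, 1, 1, 22976860, 22976860⟩,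
   ⟨0, 3, 7, 64656050, 159451714⟩, ⟨0, 1, 5, 20475644, 119144012⟩,
   ⟨0, 11, 23, 240468037, 521549689⟩, ⟨0, 5, 9, 113571351, 208282227⟩,
   ⟨0, 3, 6, 65472665, 135743078⟩, ⟨0, 3, 5, 67496987, 114852425⟩,
   ⟨0, 12, 21, 265157120, 473489354⟩, ⟨0, 6, 9, 136627204, 206834026⟩,
   ⟨0, 3, 4, 70337924, 93994446⟩, ⟨0, 1, 4, 20747849, 93922790⟩,
   ⟨0, 11, 20, 243462292, 451794526⟩, ⟨0, 5, 8, 114932376, 185139198⟩,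
   ⟨0, 11, 17, 250884806, 391298450⟩, ⟨0, 5, 7, 118306246, 165619290⟩,
   ⟨0, 4, 13, 84080216, 301126034⟩, ⟨0, 44, 71, 985826188, 1603385875⟩,
   ⟨0, 22, 31, 507758122, 715899583⟩, ⟨0, 11, 14, 261301575, 331444806⟩,
   ⟨0, 20, 29, 465173604, 673315065⟩, ⟨0, 10, 13, 239334542, 309477773⟩,
   ⟨0, 5, 6, 123041141, 146676466⟩]

theorem isComplete_d3_g11 : IsComplete 3
    [6373920, 3688469, 1752117, 402569]
    lowerTypes_d3_g11 :=
  .cons _ _ (by decide +kernel) (.cons _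
    [⟨1, 1, 1, 1610276, 5298745⟩, ⟨1, 2, 1, 3764962, 4896176⟩, ⟨1, 4, 1, 8618744, 4493607⟩,
     ⟨0, 1, 2, 2557255, 7050862⟩, ⟨0, 2, 3, 5658920, 9749958⟩, ⟨0, 1, 1, 3504234, 3504234⟩]
    (by decide +kernel) (.cons _
    [⟨1, 1, 1, 0, 1752117⟩, ⟨0, 1, 1, 805138, 805138⟩, ⟨0, 1, 2, 402569, 2154686⟩]
    (by decide +kernel) (.leaf _)))

theorem isComplete_cons_d3_g11 : IsComplete 3
    [8629016, 6373920, 3688469, 1752117, 402569]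
    upperTypes_d3_g11 :=
  .cons _ _ (by decide +kernel) isComplete_d3_g11

theorem edgeCheck_d3_g11 : edgeCheck 44573320 8629016 2
    lowerTypes_d3_g11 upperTypes_d3_g11 = true := by
  decide +kernel

/-- Branch data with `s = 1` for degree 3 and girth 12. -/
def inTypes_d3_g12 : List ForestType :=
  [⟨1, 9, 4, 94952537077699950, 72832569225811780⟩,
   ⟨1, 15, 6, 158784386847406925, 108007390166540095⟩,
   ⟨1, 21, 6, 229233530933351725, 106779810797506495⟩,
   ⟨1, 9, 2, 102108772301504100, 35584014063739515⟩,
   ⟨1, 18, 4, 200642851140376425, 71195796733766980⟩,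
   ⟨1, 3, 2, 30440505888439075, 36817231460715365⟩,
   ⟨1, 33, 6, 373134375792788225, 105552231428472895⟩,
   ⟨1, 15, 2, 176174262759512600, 35174820940728315⟩,
   ⟨1, 25, 9, 265524242053301000, 160148889741543780⟩,
   ⟨1, 10, 3, 109808803628478075, 53369078944037285⟩,
   ⟨1, 20, 6, 216673406795956275, 106779810797506495⟩,
   ⟨1, 35, 9, 383292921119591450, 158307520687993380⟩,
   ⟨1, 15, 3, 170711445553747175, 52755289259520485⟩,
   ⟨1, 30, 6, 335465068669774725, 105552231428472895⟩,
   ⟨1, 5, 3, 50910895942256350, 54605115354984260⟩,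
   ⟨1, 55, 9, 623834540398083850, 156466151634442980⟩,
   ⟨1, 25, 3, 294507368573477125, 52141499575003685⟩,
   ⟨1, 4, 1, 45363164174254300, 17785064880297770⟩,
   ⟨1, 8, 2, 89548648164108650, 35584014063739515⟩,
   ⟨1, 14, 3, 158355917977857325, 52755289259520485⟩,
   ⟨1, 6, 1, 70444042305793475, 17580468318792170⟩,
   ⟨1, 12, 2, 138504955636499100, 35174820940728315⟩,
   ⟨1, 2, 1, 21084179738334075, 18197077017280095⟩,
   ⟨1, 22, 3, 257451851134980425, 52141499575003685⟩,
   ⟨1, 10, 1, 121402054236548525, 17375871757286570⟩,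
   ⟨1, 4, 1, 44185483989854350, 17798949183441745⟩,
   ⟨1, 28, 6, 312589955310314825, 105552231428472895⟩,
   ⟨1, 12, 2, 136738435359899175, 35188705243872290⟩,
   ⟨1, 4, 2, 41579519384468175, 36408038337704165⟩,
   ⟨1, 44, 6, 508426461255761125, 104324652059439295⟩,
   ⟨1, 20, 2, 239859908012097175, 34765627817717115⟩,
   ⟨1, 49, 9, 552792664710386100, 156466151634442980⟩,
   ⟨1, 21, 3, 245931413122228075, 52141499575003685⟩,
   ⟨1, 42, 6, 483521874831648675, 104324652059439295⟩,
   ⟨1, 7, 3, 73587050768152900, 53991325670467460⟩,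
   ⟨1, 77, 9, 898798117496251500, 154624782580892580⟩,
   ⟨1, 35, 3, 423869298247838025, 51527709890486885⟩,
   ⟨1, 9, 1, 109265007525308250, 17375871757286570⟩,
   ⟨1, 18, 2, 214955321587984725, 34765627817717115⟩,
   ⟨1, 3, 1, 32825917629707125, 17992480455774495⟩,
   ⟨1, 33, 3, 399373904946736775, 51527709890486885⟩,
   ⟨1, 15, 1, 188101321465852850, 17171275195780970⟩,
   ⟨1, 9, 1, 105690314062676475, 17389756060430545⟩,
   ⟨1, 6, 2, 64460270771870325, 35998845214692965⟩,
   ⟨1, 66, 6, 785640600530490375, 103097072690405695⟩,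
   ⟨1, 30, 2, 370244820493986075, 34356434694705915⟩,
   ⟨1, 1, 1, 9743388694770500, 18609089154262420⟩,
   ⟨1, 11, 3, 119940212649128300, 53377535985950660⟩,
   ⟨1, 121, 9, 1459734646213592100, 152783413527342180⟩,
   ⟨1, 55, 3, 687597418742471325, 50913920205970085⟩,
   ⟨1, 25, 1, 323490495093653250, 16966678634275370⟩]

/-- Branch data with `s = 0` for degree 3 and girth 12. -/
def outTypes_d3_g12 : List ForestType :=
  [⟨0, 3, 11, 36468749345765275, 173983010437971735⟩,
   ⟨0, 3, 9, 36759046254264400, 138653278401241670⟩,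
   ⟨0, 3, 7, 37663132847280325, 105574108541073205⟩,
   ⟨0, 12, 30, 148197372651054100, 450155678075453185⟩,
   ⟨0, 6, 12, 75906859511558900, 176531859380070645⟩,
   ⟨0, 3, 5, 38857516348795375, 72389926769536640⟩,
   ⟨0, 5, 17, 60957968371133350, 264746432665087890⟩,
   ⟨0, 10, 28, 122883593103930450, 424841898528329535⟩,
   ⟨0, 5, 11, 62948607540325100, 163573607408836845⟩,
   ⟨0, 20, 47, 247702498931188400, 695053370542987940⟩,
   ⟨0, 10, 19, 126864871442313950, 275940175736815205⟩,
   ⟨0, 5, 8, 64939246709516850, 114617130504539960⟩,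
   ⟨0, 16, 34, 201565209667603100, 499840776984901385⟩,
   ⟨0, 8, 14, 103193502415177350, 202590922914655495⟩,
   ⟨0, 4, 6, 52802199998276575, 85925417296006640⟩,
   ⟨0, 7, 19, 87652952168580700, 288986257724468040⟩,
   ⟨0, 14, 32, 176660623243490650, 474936190560788935⟩,
   ⟨0, 7, 13, 90439847005449150, 189837267504927295⟩,
   ⟨0, 28, 55, 356030684299639800, 797857448750788140⟩,
   ⟨0, 14, 23, 182234412917227550, 329468348158178405⟩,
   ⟨0, 7, 10, 93226741842317600, 142290835952823910⟩,
   ⟨0, 1, 1, 13762217666321300, 13762217666321300⟩,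
   ⟨0, 6, 14, 76516757686522725, 210757473794639585⟩,
   ⟨0, 1, 5, 11752803180545900, 81311827422268080⟩,
   ⟨0, 11, 23, 142043771992657700, 340921918810477840⟩,
   ⟨0, 5, 9, 66754593675168575, 133028796876916655⟩,
   ⟨0, 8, 14, 103570593760692300, 201768203497424795⟩,
   ⟨0, 12, 18, 158972237013102150, 257142078143546695⟩,
   ⟨0, 6, 8, 81294291692582925, 114008315867301790⟩,
   ⟨0, 2, 8, 23699137633424550, 126796210323830245⟩,
   ⟨0, 22, 40, 286216387980975650, 580809217191173135⟩,
   ⟨0, 1, 3, 12150931014384250, 46507365709090165⟩,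
   ⟨0, 11, 17, 146423178164879550, 244593019295324095⟩,
   ⟨0, 5, 7, 68745232844360325, 101459257019079190⟩,
   ⟨0, 4, 13, 47785337811514600, 200568751338856780⟩,
   ⟨0, 2, 5, 24495393301101250, 75409313507071335⟩,
   ⟨0, 1, 2, 12549058848222600, 29515737482497970⟩,
   ⟨0, 44, 71, 576690463953271800, 1012993121243768940⟩,
   ⟨0, 22, 31, 294975200325419350, 440367766512819805⟩,
   ⟨0, 11, 14, 150802584337101400, 199252888763090910⟩,
   ⟨0, 20, 29, 270889000147329300, 416281566334729755⟩,
   ⟨0, 10, 13, 138458122050384400, 186908426476373910⟩,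
   ⟨0, 5, 6, 70735872013552075, 86881345387833920⟩]

theorem isComplete_d3_g12 : IsComplete 3
    [8865700459491920, 4448080673439150, 2026654050681425, 807320956849550, 204596561505600]
    (inTypes_d3_g12 ++ outTypes_d3_g12) :=
  .cons _ _ (by decide +kernel) (.cons _
    [⟨1, 4, 1, 14609445014213500, 6881108833160650⟩,
     ⟨1, 6, 2, 20672703849142675, 13955748938654050⟩,
     ⟨1, 2, 1, 6881645080951575, 7279236666999000⟩,
     ⟨1, 9, 4, 29146860265447650, 28298560421973600⟩,
     ⟨1, 3, 2, 9701735785338575, 14752004606330750⟩,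
     ⟨1, 1, 1, 3229283827398200, 7677364500837350⟩,
     ⟨0, 2, 3, 9342441846961025, 15825422846283325⟩,
     ⟨0, 3, 5, 13392930934352750, 26552424205330100⟩,
     ⟨0, 1, 2, 4459682210402925, 11340791043563575⟩,
     ⟨0, 2, 4, 8933248723949825, 22092741994927175⟩,
     ⟨0, 3, 7, 12779141249835950, 39485190336456150⟩,
     ⟨0, 1, 3, 4255085648897325, 18210834587551375⟩,
     ⟨0, 2, 6, 8524055600938625, 35230104687558825⟩,
     ⟨0, 1, 1, 4871694347385250, 4871694347385250⟩,
     ⟨0, 3, 11, 12165351565319150, 66351574827890550⟩,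
     ⟨0, 1, 5, 4050489087391725, 32349049509365325⟩]
    (by decide +kernel) (.cons _
    [⟨1, 1, 1, 818386246022400, 2845040296703825⟩, ⟨1, 2, 1, 1830303764377550, 2640443735198225⟩,
     ⟨1, 4, 1, 4047670073420600, 2435847173692625⟩, ⟨0, 1, 2, 1216514079860750, 3652361253553375⟩,
     ⟨0, 2, 3, 2626559432054250, 4857810044241275⟩, ⟨0, 1, 1, 1614641913699100, 1614641913699100⟩]
    (by decide +kernel) (.cons _
    [⟨1, 1, 1, 0, 807320956849550⟩, ⟨0, 1, 1, 409193123011200, 409193123011200⟩,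
     ⟨0, 1, 2, 204596561505600, 1011917518355150⟩]
    (by decide +kernel) (.leaf _))))

theorem vertexCheck_d3_g12 : vertexCheck
    47367845802313588 12109436260675888 3 13762217666321300 3204460967954070 1 11752803180545900 1
    inTypes_d3_g12 outTypes_d3_g12 = true := by
  decide +kernel

/-- Branch data with `s = 1` for degree 4 and girth 8. -/
def inTypes_d4_g8 : List ForestType :=
  [⟨1, 1, 1, 279456, 825816⟩, ⟨1, 2, 1, 615712, 779240⟩, ⟨1, 4, 1, 1345024, 732664⟩,
   ⟨1, 8, 1, 2917248, 686088⟩]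

/-- Branch data with `s = 0` for degree 4 and girth 8. -/
def outTypes_d4_g8 : List ForestType :=
  [⟨0, 1, 2, 382832, 1115496⟩, ⟨0, 2, 3, 822464, 1508552⟩, ⟨0, 1, 1, 486208, 486208⟩,
   ⟨0, 4, 5, 1758528, 2398040⟩]

theorem isComplete_d4_g8 : IsComplete 4
    [546360, 196528, 46576]
    (inTypes_d4_g8 ++ outTypes_d4_g8) :=
  .cons _ _ (by decide +kernel) (.cons _
    [⟨1, 1, 1, 0, 196528⟩, ⟨0, 1, 1, 93152, 93152⟩, ⟨0, 1, 2, 46576, 243104⟩]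
    (by decide +kernel) (.leaf _))

theorem vertexCheck_d4_g8 : vertexCheck
    2331392 863415 4 479608 206480 1 382832 1
    inTypes_d4_g8 outTypes_d4_g8 = true := by
  decide +kernel

/-- Branch data below an end of an edge for degree 4 and girth 9. -/
def lowerTypes_d4_g9 : List ForestType :=
  [⟨1, 1, 1, 4788, 18684⟩, ⟨1, 2, 1, 11294, 17886⟩, ⟨1, 4, 1, 26024, 17088⟩,
   ⟨1, 8, 1, 58920, 16290⟩, ⟨0, 1, 2, 7304, 24392⟩, ⟨0, 2, 3, 16326, 32616⟩,
   ⟨0, 1, 1, 9820, 9820⟩, ⟨0, 4, 5, 36088, 51580⟩]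

/-- Branch data at an end of an edge for degree 4 and girth 9. -/
def upperTypes_d4_g9 : List ForestType :=
  [⟨1, 8, 1, 292704, 49607⟩, ⟨1, 6, 1, 211584, 50466⟩, ⟨1, 4, 1, 136848, 52123⟩,
   ⟨1, 5, 1, 173540, 51325⟩, ⟨1, 9, 2, 305460, 102650⟩, ⟨1, 3, 1, 98664, 52982⟩,
   ⟨1, 15, 4, 500760, 208736⟩, ⟨1, 2, 1, 63672, 54639⟩, ⟨1, 5, 2, 161660, 107682⟩,
   ⟨1, 25, 8, 820700, 424344⟩, ⟨1, 27, 8, 880632, 417472⟩, ⟨1, 9, 4, 284076, 215364⟩,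
   ⟨1, 45, 16, 1442700, 848688⟩, ⟨1, 3, 2, 91536, 110996⟩, ⟨1, 15, 8, 465120, 437600⟩,
   ⟨1, 75, 32, 2362800, 1724864⟩, ⟨1, 1, 1, 29460, 57155⟩, ⟨1, 5, 4, 149780, 225428⟩,
   ⟨1, 25, 16, 761300, 888944⟩, ⟨1, 125, 64, 3868500, 3504704⟩, ⟨0, 4, 5, 172304, 219395⟩,
   ⟨0, 3, 4, 125256, 173206⟩, ⟨0, 2, 3, 81400, 131007⟩, ⟨0, 5, 7, 205980, 303598⟩,
   ⟨0, 9, 13, 363852, 559088⟩, ⟨0, 3, 5, 118128, 219060⟩, ⟨0, 15, 23, 598080, 995424⟩,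
   ⟨0, 1, 2, 38324, 90447⟩, ⟨0, 5, 9, 194100, 399400⟩, ⟨0, 25, 41, 982900, 1791332⟩,
   ⟨0, 1, 2, 39902, 90368⟩, ⟨0, 9, 17, 356670, 754014⟩, ⟨0, 3, 7, 115734, 321034⟩,
   ⟨0, 15, 31, 586110, 1394542⟩, ⟨0, 1, 3, 37526, 143490⟩, ⟨0, 5, 13, 190110, 607582⟩,
   ⟨0, 25, 57, 962950, 2607302⟩, ⟨0, 1, 2, 41480, 90289⟩, ⟨0, 1, 3, 40682, 140018⟩,
   ⟨0, 3, 7, 120468, 319140⟩, ⟨0, 1, 3, 39104, 141754⟩, ⟨0, 5, 13, 198000, 602216⟩,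
   ⟨0, 3, 11, 118074, 522290⟩, ⟨0, 1, 5, 38306, 247042⟩, ⟨0, 5, 21, 194010, 1016186⟩,
   ⟨0, 9, 25, 349488, 1157920⟩, ⟨0, 3, 11, 113340, 530812⟩, ⟨0, 15, 47, 574140, 2218492⟩,
   ⟨0, 1, 5, 36728, 252092⟩, ⟨0, 5, 21, 186120, 1034808⟩, ⟨0, 25, 89, 943000, 4286680⟩,
   ⟨0, 9, 41, 342306, 1986658⟩, ⟨0, 3, 19, 110946, 959634⟩, ⟨0, 15, 79, 562170, 3905850⟩,
   ⟨0, 1, 9, 35930, 473530⟩, ⟨0, 1, 1, 42400, 42400⟩, ⟨0, 5, 37, 182130, 1906994⟩,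
   ⟨0, 25, 153, 923050, 7720362⟩]

theorem isComplete_d4_g9 : IsComplete 4
    [13896, 4112, 798]
    lowerTypes_d4_g9 :=
  .cons _ _ (by decide +kernel) (.cons _
    [⟨1, 1, 1, 0, 4112⟩, ⟨0, 1, 1, 1596, 1596⟩, ⟨0, 1, 2, 798, 4910⟩]
    (by decide +kernel) (.leaf _))

theorem isComplete_cons_d4_g9 : IsComplete 4
    [27695, 13896, 4112, 798]
    upperTypes_d4_g9 :=
  .cons _ _ (by decide +kernel) isComplete_d4_g9

theorem edgeCheck_d4_g9 : edgeCheck 84800 27695 3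
    lowerTypes_d4_g9 upperTypes_d4_g9 = true := by
  decide +kernel

/-- Branch data with `s = 1` for degree 4 and girth 10. -/
def inTypes_d4_g10 : List ForestType :=
  [⟨1, 8, 1, 769116, 166739⟩, ⟨1, 6, 1, 550340, 169592⟩, ⟨1, 4, 1, 341412, 173676⟩,
   ⟨1, 5, 1, 447889, 172445⟩, ⟨1, 18, 4, 1571529, 689780⟩, ⟨1, 6, 2, 485621, 353058⟩,
   ⟨1, 30, 8, 2554849, 1402384⟩, ⟨1, 2, 1, 149133, 180613⟩, ⟨1, 10, 4, 787913, 717528⟩,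
   ⟨1, 50, 16, 4150805, 2850416⟩, ⟨1, 27, 8, 2238057, 1402384⟩, ⟨1, 9, 4, 688686, 717528⟩,
   ⟨1, 45, 16, 3633546, 2850416⟩, ⟨1, 3, 2, 210451, 366932⟩, ⟨1, 15, 8, 1115627, 1457880⟩,
   ⟨1, 75, 32, 5894995, 5792128⟩, ⟨1, 1, 1, 63780, 187550⟩, ⟨1, 5, 4, 340024, 745276⟩,
   ⟨1, 25, 16, 1805740, 2961408⟩, ⟨1, 125, 64, 9556800, 11766848⟩]

/-- Branch data with `s = 0` for degree 4 and girth 10. -/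
def outTypes_d4_g10 : List ForestType :=
  [⟨0, 4, 5, 465300, 625102⟩, ⟨0, 6, 8, 671453, 996763⟩, ⟨0, 2, 3, 211077, 377816⟩,
   ⟨0, 10, 14, 1097633, 1759665⟩, ⟨0, 9, 13, 967434, 1629466⟩, ⟨0, 3, 5, 303367, 642551⟩,
   ⟨0, 15, 23, 1580207, 2927095⟩, ⟨0, 1, 2, 94752, 268428⟩, ⟨0, 5, 9, 494884, 1184664⟩,
   ⟨0, 25, 41, 2580040, 5319464⟩, ⟨0, 9, 17, 956355, 2303243⟩, ⟨0, 3, 7, 299674, 989454⟩,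
   ⟨0, 15, 31, 1561742, 4301166⟩, ⟨0, 1, 3, 93521, 446579⟩, ⟨0, 5, 13, 488729, 1891113⟩,
   ⟨0, 25, 57, 2549265, 8119409⟩, ⟨0, 6, 22, 649295, 3388719⟩, ⟨0, 2, 10, 203691, 1606075⟩,
   ⟨0, 10, 42, 1060703, 6630847⟩, ⟨0, 9, 25, 945276, 3684700⟩, ⟨0, 3, 11, 295981, 1698365⟩,
   ⟨0, 15, 47, 1543277, 7113421⟩, ⟨0, 1, 5, 92290, 809818⟩, ⟨0, 5, 21, 482574, 3332990⟩,
   ⟨0, 25, 89, 2518490, 13841370⟩, ⟨0, 9, 41, 934197, 6504341⟩, ⟨0, 3, 19, 292288, 3142704⟩,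
   ⟨0, 15, 79, 1524812, 12847692⟩, ⟨0, 1, 9, 91059, 1548939⟩, ⟨0, 1, 1, 118338, 118338⟩,
   ⟨0, 5, 37, 476419, 6268547⟩, ⟨0, 25, 153, 2487715, 25498659⟩]

theorem isComplete_d4_g10 : IsComplete 4
    [123770, 44846, 9399, 1231]
    (inTypes_d4_g10 ++ outTypes_d4_g10) :=
  .cons _ _ (by decide +kernel) (.cons _
    [⟨1, 1, 1, 7386, 52232⟩, ⟨1, 2, 1, 20478, 51001⟩, ⟨1, 4, 1, 52368, 49770⟩,
     ⟨1, 8, 1, 127560, 48539⟩, ⟨0, 1, 2, 14323, 64093⟩, ⟨0, 2, 3, 34352, 82891⟩,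
     ⟨0, 1, 1, 21260, 21260⟩, ⟨0, 4, 5, 80116, 127424⟩]
    (by decide +kernel) (.cons _
    [⟨1, 1, 1, 0, 9399⟩, ⟨0, 1, 1, 2462, 2462⟩, ⟨0, 1, 2, 1231, 10630⟩]
    (by decide +kernel) (.leaf _)))

theorem vertexCheck_d4_g10 : vertexCheck
    570154 205918 4 118338 48401 1 91059 1
    inTypes_d4_g10 outTypes_d4_g10 = true := by
  decide +kernel

end ForestType

end

/-! ### Assembly of the table -/

open SimpleGraph ForestType

theorem hallRatioSup_le_of_mul_card_le {d g D N : ℕ} (hg : 2 ≤ g) {b : ℚ} (hD : 0 < D)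
    (hb : (N : ℚ) ≤ D * b)
    (H : ∀ (W : Type) [Fintype W] [DecidableEq W] (G : SimpleGraph W) [DecidableRel G.Adj],
      G.IsRegularOfDegree d → (g : ℕ∞) ≤ G.egirth →
        (D : ℝ) * Fintype.card W ≤ (N : ℕ) * G.indepNum) :
    hallRatioSup d g ≤ ((b : ℝ) : EReal) := by
  have hD' : (0 : ℝ) < D := by exact_mod_cast hD
  have hb' : (N : ℝ) ≤ D * b := by exact_mod_cast hb
  refine hallRatioSup_le hg ?_ fun W _ _ G _ hd hG => ?_
  · exact nonneg_of_mul_nonneg_right ((Nat.cast_nonneg N).trans hb') hD'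
  · refine le_of_mul_le_mul_left ((H W G hd hG).trans ?_) hD'
    rw [← mul_assoc]
    exact mul_le_mul_of_nonneg_right hb' (Nat.cast_nonneg _)

theorem hallRatioSup_le_of_vertexCheck {D a d x y E x' E' : ℕ} {l : List ℕ}
    {L₁ L₀ : List ForestType} (hL : IsComplete d l (L₁ ++ L₀))
    (h : vertexCheck D a d x y E x' E' L₁ L₀ = true) (hD : 0 < D) {b : ℚ}
    (hb : ((a + d * totalWeight d l : ℕ) : ℚ) ≤ D * b) :
    hallRatioSup d (2 * l.length + 2) ≤ ((b : ℝ) : EReal) :=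
  hallRatioSup_le_of_mul_card_le (by omega) hD hb fun _ _ _ _ _ hd hg =>
    mul_card_le_of_vertex_check hd hL (rootOK_of_vertexCheck h) hg

theorem hallRatioSup_le_of_edgeCheck {D a d : ℕ} {l : List ℕ} {L L' : List ForestType}
    (hL : IsComplete d l L) (hL' : IsComplete d (a :: l) L') (hd : 0 < d)
    (h : edgeCheck D a (d - 1) L L' = true) (hD : 0 < D) {b : ℚ}
    (hb : ((2 * totalWeight d (a :: l) : ℕ) : ℚ) ≤ D * b) :
    hallRatioSup d (2 * l.length + 3) ≤ ((b : ℝ) : EReal) :=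
  hallRatioSup_le_of_mul_card_le (by omega) hD hb fun _ _ _ _ _ hG hg =>
    mul_card_le_of_edge_check hG hd hL hL' (rootOK_of_edgeCheck h) hg

theorem hallRatioSup_le_of_cherryOK {B C D d g : ℕ} (hg : 6 ≤ g)
    (h : allProducts (cherryOK D C d) d (cherryTypes B C) 1 = true) (hD : 0 < D) {b : ℚ}
    (hb : ((D + B * d : ℕ) : ℚ) ≤ D * b) :
    hallRatioSup d g ≤ ((b : ℝ) : EReal) :=
  hallRatioSup_le_of_mul_card_le (by omega) hD hb fun _ _ _ _ _ hG hg' =>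
    mul_card_le_of_cherry_check hG h (le_trans (by exact_mod_cast hg) hg')

/-- The ratio (D + B·d)/D is 19/7 < 30/11 here, 59/19 < 41/13 for degree four and 7/2 for degree
five. So girth six alone settles column 7, and for degree five column 8 as well. -/
theorem cherryOK_d3 : allProducts (cherryOK 7 2 3) 3 (cherryTypes 4 2) 1 = true := by
  decide +kernel

theorem cherryOK_d4 : allProducts (cherryOK 19 4 4) 4 (cherryTypes 10 4) 1 = true := by
  decide +kernel

theorem cherryOK_d5 : allProducts (cherryOK 6 1 5) 5 (cherryTypes 3 1) 1 = true := by
  decide +kernel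

theorem theorem1p12 :
    ∀ d g : ℕ, ∀ b : ℚ, (d, g, b) ∈ hallRatioTable →
      hallRatioSup d g ≤ (((b : ℚ) : ℝ) : EReal) := by
  intro d g b h
  simp only [hallRatioTable, List.mem_cons, Prod.mk.injEq, List.not_mem_nil, or_false] at h
  rcases h with ⟨rfl, rfl, rfl⟩ | ⟨rfl, rfl, rfl⟩ | ⟨rfl, rfl, rfl⟩ | ⟨rfl, rfl, rfl⟩ |
    ⟨rfl, rfl, rfl⟩ | ⟨rfl, rfl, rfl⟩ | ⟨rfl, rfl, rfl⟩ | ⟨rfl, rfl, rfl⟩ | ⟨rfl, rfl, rfl⟩ |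
    ⟨rfl, rfl, rfl⟩ | ⟨rfl, rfl, rfl⟩ | ⟨rfl, rfl, rfl⟩ | ⟨rfl, rfl, rfl⟩ | ⟨rfl, rfl, rfl⟩ |
    ⟨rfl, rfl, rfl⟩
  · exact hallRatioSup_le_of_cherryOK (by norm_num) cherryOK_d3 (by norm_num) (by norm_num)
  · exact hallRatioSup_le_of_cherryOK (by norm_num) cherryOK_d3 (by norm_num) (by norm_num)
  · exact hallRatioSup_le_of_vertexCheck isComplete_d3_g8 vertexCheck_d3_g8 (by norm_num)
      (by norm_num [totalWeight])
  · exact hallRatioSup_le_of_edgeCheck isComplete_d3_g9 isComplete_cons_d3_g9 (by norm_num)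
      edgeCheck_d3_g9 (by norm_num) (by norm_num [totalWeight])
  · exact hallRatioSup_le_of_vertexCheck isComplete_d3_g10 vertexCheck_d3_g10 (by norm_num)
      (by norm_num [totalWeight])
  · exact hallRatioSup_le_of_edgeCheck isComplete_d3_g11 isComplete_cons_d3_g11 (by norm_num)
      edgeCheck_d3_g11 (by norm_num) (by norm_num [totalWeight])
  · exact hallRatioSup_le_of_vertexCheck isComplete_d3_g12 vertexCheck_d3_g12 (by norm_num)
      (by norm_num [totalWeight])
  · exact hallRatioSup_le_of_cherryOK (by norm_num) cherryOK_d4 (by norm_num) (by norm_num)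
  · exact hallRatioSup_le_of_cherryOK (by norm_num) cherryOK_d4 (by norm_num) (by norm_num)
  · exact hallRatioSup_le_of_vertexCheck isComplete_d4_g8 vertexCheck_d4_g8 (by norm_num)
      (by norm_num [totalWeight])
  · exact hallRatioSup_le_of_edgeCheck isComplete_d4_g9 isComplete_cons_d4_g9 (by norm_num)
      edgeCheck_d4_g9 (by norm_num) (by norm_num [totalWeight])
  · exact hallRatioSup_le_of_vertexCheck isComplete_d4_g10 vertexCheck_d4_g10 (by norm_num)
      (by norm_num [totalWeight])
  · exact hallRatioSup_le_of_cherryOK (by norm_num) cherryOK_d5 (by norm_num) (by norm_num)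
  · exact hallRatioSup_le_of_cherryOK (by norm_num) cherryOK_d5 (by norm_num) (by norm_num)
  · exact hallRatioSup_le_of_cherryOK (by norm_num) cherryOK_d5 (by norm_num) (by norm_num)
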